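/- Let $Y\subseteq\mathbb R^n$ be nonempty, closed, convex and bounded with diameter $D$, let $\ell>0$, and let $f:\mathbb R^m\times\mathbb R^n\to\mathbb R$ be $\ell$-smooth (differentiable with $\ell$-Lipschitz gradient, jointly in both variables) with $f(x,\cdot)$ concave on $Y$ for every $x$. Put $\Phi(x)=\max_{y\in Y}f(x,y)$ and $\Phi_{1/2\ell}(x)=\min_{w}\{\Phi(w)+\ell\|w-x\|^2\}$. A point $x\in\mathbb R^m$ is an $\epsilon$-stationary point of $\Phi$ if $\Phi_{1/2\ell}$ is differentiable at $x$ and $\|\nabla\Phi_{1/2\ell}(x)\|\le\epsilon$. A pair $(x,y)\in\mathbb R^m\times Y$ is an $\epsilon$-stationary point of $f$ if $\|\nabla_xf(x,y^+)\|\le\epsilon$ and $\|y^+-y\|\le\epsilon/\ell$, where $y^+=P_Y\bigl(y+\tfrac1\ell\nabla_yf(x,y)\bigr)$ and $P_Y$ is the orthogonal projection onto $Y$. A random pair $(x,y)$ with values in $\mathbb R^m\times Y$ is $\epsilon$-stationary for $f$ in expectation if $\mathbb E\|\nabla_xf(x,y^+)\|^2\le\epsilon^2$ and $\mathbb E\|y^+-y\|^2\le(\epsilon/\ell)^2$.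 A stochastic gradient of $f$ with variance at most $\sigma^2$ is a measurable map $G(x,y,\xi)$ of the point and of a random sample $\xi$ with $\mathbb E\,G(x,y,\xi)=\nabla f(x,y)$ and $\mathbb E\|G(x,y,\xi)-\nabla f(x,y)\|^2\le\sigma^2$ for all $(x,y)$. Below, a method is an adaptive rule that may depend on $m,n,\ell,Y,\epsilon,\hat x$ (and on $\sigma$ in part 2), but that learns about $f$ only through its gradient evaluations. There is an absolute constant $K$ such that the following hold for all such $m,n,\ell,Y$. 1. For all $\epsilon>0$ and $\hat x\in\mathbb R^m$ there is a method that makes at most $K\,\ell^2D^2\,\epsilon^{-2}$ gradient evaluations and that, for every $f$ as above for which $\hat x$ is an $\epsilon$-stationary point of $\Phi$, returns a $4\epsilon$-stationary point $(x',y')$ of $f$. In particular $O(\epsilon^{-2})$ gradient evaluations suffice for fixed $\ell$ and $D$. 2. For all $\sigma\ge0$, $\epsilon>0$ and $\hat x\in\mathbb R^m$ there is a (measurable) method that makes at most $K\,\ell^2D^2(\ell^2D^2+\sigma^2)\,\epsilon^{-4}$ stochastic gradient evaluations and that, for every $f$ as above for which $\hat x$ is an $\epsilon$-stationary point of $\Phi$,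 and for every stochastic gradient of $f$ with variance at most $\sigma^2$, queried with independent identically distributed samples, returns a random pair $(x',y')$ that is $4\epsilon$-stationary for $f$ in expectation. In particular $O(\epsilon^{-4})$ stochastic gradient evaluations suffice for fixed $\ell$, $D$ and $\sigma$. 3. Conversely, for every $f$ as above and every $\epsilon\ge0$, if $(\hat x,\hat y)$ is an $\frac{\epsilon^2}{\max\{1,\ell D\}}$-stationary point of $f$, then $\hat x$ is a $(4\epsilon^2+4\epsilon)$-stationary point of $\Phi$. -/

import Mathlib

open MeasureTheory ProbabilityTheory

/-- The Euclidean space `ℝᵐ`. -/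
abbrev Euc (m : ℕ) : Type := EuclideanSpace ℝ (Fin m)

/-- `∇ₓ f (x, y)`. -/
noncomputable def gradX {m n : ℕ} (f : Euc m → Euc n → ℝ) (x : Euc m) (y : Euc n) : Euc m :=
  gradient (fun x' => f x' y) x

/-- `∇_y f (x, y)`. -/
noncomputable def gradY {m n : ℕ} (f : Euc m → Euc n → ℝ) (x : Euc m) (y : Euc n) : Euc n :=
  gradient (f x) y

/-- The answer of the exact gradient oracle of `f` at the point `z = (x, y)`. -/
noncomputable def gradPair {m n : ℕ} (f : Euc m → Euc n → ℝ) (z : Euc m × Euc n) :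
    Euc m × Euc n :=
  (gradX f z.1 z.2, gradY f z.1 z.2)

/-- `g` is `ℓ`-smooth: differentiable, with an `ℓ`-Lipschitz gradient. -/
def IsSmoothWith {V : Type*} [NormedAddCommGroup V] [InnerProductSpace ℝ V] [CompleteSpace V]
    (ℓ : ℝ) (g : V → ℝ) : Prop :=
  Differentiable ℝ g ∧ ∀ z z' : V, ‖gradient g z - gradient g z'‖ ≤ ℓ * ‖z - z'‖

/-- `f : ℝᵐ × ℝⁿ → ℝ` is `ℓ`-smooth jointly in `(x, y)` for the Euclidean norm on `ℝᵐ × ℝⁿ`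
(`WithLp 2` selects this norm on the product), and `f (x, ·)` is concave on `Y` for every `x`. -/
structure IsSmoothConcave {m n : ℕ} (ℓ : ℝ) (Y : Set (Euc n)) (f : Euc m → Euc n → ℝ) : Prop where
  smooth : IsSmoothWith ℓ (fun z : WithLp 2 (Euc m × Euc n) => f z.fst z.snd)
  concave : ∀ x, ConcaveOn ℝ Y (f x)

/-- A constraint set: nonempty, closed, convex, bounded, of diameter `D`. -/
structure IsConstraintSet {n : ℕ} (D : ℝ) (Y : Set (Euc n)) : Prop where
  nonempty : Y.Nonempty
  closed : IsClosed Y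
  convex : Convex ℝ Y
  bounded : Bornology.IsBounded Y
  diam_eq : Metric.diam Y = D

/-- The orthogonal projection `P_Y z`: the point of `Y` nearest to `z`
(for `Y` nonempty, closed and convex, see `projSet_eq_iff`). -/
noncomputable def projSet {n : ℕ} (Y : Set (Euc n)) (z : Euc n) : Euc n :=
  Classical.epsilon fun p => p ∈ Y ∧ ∀ q ∈ Y, ‖z - p‖ ≤ ‖z - q‖

theorem projSet_spec {n : ℕ} {Y : Set (Euc n)} (hne : Y.Nonempty) (hcl : IsClosed Y)
    (z : Euc n) : projSet Y z ∈ Y ∧ ∀ q ∈ Y, ‖z - projSet Y z‖ ≤ ‖z - q‖ := by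
  refine Classical.epsilon_spec (p := fun p => p ∈ Y ∧ ∀ q ∈ Y, ‖z - p‖ ≤ ‖z - q‖) ?_
  obtain ⟨p, hp, h⟩ := hcl.exists_infDist_eq_dist hne z
  refine ⟨p, hp, fun q hq => ?_⟩
  rw [← dist_eq_norm, ← dist_eq_norm, ← h]
  exact Metric.infDist_le_dist_of_mem hq

theorem projSet_eq_iff {n : ℕ} {Y : Set (Euc n)} (hne : Y.Nonempty) (hcl : IsClosed Y)
    (hcv : Convex ℝ Y) (z p : Euc n) :
    projSet Y z = p ↔ p ∈ Y ∧ ∀ q ∈ Y, ‖z - p‖ ≤ ‖z - q‖ := by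
  constructor
  · rintro rfl
    exact projSet_spec hne hcl z
  · rintro ⟨hp, h⟩
    obtain ⟨hp', h'⟩ := projSet_spec hne hcl z
    have key : ∀ v ∈ Y, (∀ q ∈ Y, ‖z - v‖ ≤ ‖z - q‖) → ∀ w ∈ Y, inner ℝ (z - v) (w - v) ≤ 0 := by
      intro v hv hmin
      refine (norm_eq_iInf_iff_real_inner_le_zero hcv hv).1 ?_
      have : Nonempty Y := ⟨⟨v, hv⟩⟩
      refine le_antisymm (le_ciInf fun w => hmin w w.2) ?_
      exact ciInf_le ⟨0, Set.forall_mem_range.2 fun _ => norm_nonneg _⟩ (⟨v, hv⟩ : Y)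
    have h1 := key _ hp h _ hp'
    have h2 := key _ hp' h' _ hp
    have h3 : inner ℝ (projSet Y z - p) (projSet Y z - p) ≤ (0 : ℝ) := by
      have e : inner ℝ (projSet Y z - p) (projSet Y z - p)
          = (inner ℝ (z - p) (projSet Y z - p) : ℝ)
            + inner ℝ (z - projSet Y z) (p - projSet Y z) := by
        rw [show p - projSet Y z = -(projSet Y z - p) by abel, inner_neg_right,
          ← sub_eq_add_neg, ← inner_sub_left]
        congr 1
        abel
      rw [e]
      linarith
    exact sub_eq_zero.1 (real_inner_self_nonpos.1 h3)

/-- `y⁺ = P_Y (y + (1/ℓ) ∇_y f (x, y))`. -/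
noncomputable def ascentStep {m n : ℕ} (ℓ : ℝ) (Y : Set (Euc n)) (f : Euc m → Euc n → ℝ)
    (x : Euc m) (y : Euc n) : Euc n :=
  projSet Y (y + (1 / ℓ) • gradY f x y)

/-- `(x, y) ∈ ℝᵐ × Y` is an `ε`-stationary point of `f`. -/
def IsStationaryPair {m n : ℕ} (ℓ : ℝ) (Y : Set (Euc n)) (f : Euc m → Euc n → ℝ) (ε : ℝ)
    (x : Euc m) (y : Euc n) : Prop :=
  y ∈ Y ∧ ‖gradX f x (ascentStep ℓ Y f x y)‖ ≤ ε ∧ ‖ascentStep ℓ Y f x y - y‖ ≤ ε / ℓ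

/-- A random pair `(x, y)` with values in `ℝᵐ × Y` is an `ε`-stationary point of `f` in
expectation (in mean square). -/
def IsStationaryPairInExpectation {m n : ℕ} {Ω : Type*} [MeasurableSpace Ω] (μ : Measure Ω)
    (ℓ : ℝ) (Y : Set (Euc n)) (f : Euc m → Euc n → ℝ) (ε : ℝ)
    (x : Ω → Euc m) (y : Ω → Euc n) : Prop :=
  (∀ ω, y ω ∈ Y) ∧
  (Integrable (fun ω => ‖gradX f (x ω) (ascentStep ℓ Y f (x ω) (y ω))‖ ^ 2) μ ∧
    ∫ ω, ‖gradX f (x ω) (ascentStep ℓ Y f (x ω) (y ω))‖ ^ 2 ∂μ ≤ ε ^ 2) ∧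
  (Integrable (fun ω => ‖ascentStep ℓ Y f (x ω) (y ω) - y ω‖ ^ 2) μ ∧
    ∫ ω, ‖ascentStep ℓ Y f (x ω) (y ω) - y ω‖ ^ 2 ∂μ ≤ (ε / ℓ) ^ 2)

/-- `Φ(x) = max_{y ∈ Y} f (x, y)`. -/
noncomputable def maxFun {m n : ℕ} (Y : Set (Euc n)) (f : Euc m → Euc n → ℝ) (x : Euc m) : ℝ :=
  ⨆ y : Y, f x y

/-- The Moreau envelope `Φ_lam(x) = min_w Φ(w) + (1 / (2 lam)) ‖w - x‖²`. -/
noncomputable def moreauEnvelope {m : ℕ} (lam : ℝ) (Φ : Euc m → ℝ) (x : Euc m) : ℝ :=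
  ⨅ w : Euc m, (Φ w + 1 / (2 * lam) * ‖w - x‖ ^ 2)

/-- `x` is an `ε`-stationary point of the `ρ`-weakly convex function `Φ`:
`‖∇ Φ_{1/(2ρ)} (x)‖ ≤ ε`. -/
def IsMoreauStationary {m : ℕ} (ρ : ℝ) (Φ : Euc m → ℝ) (ε : ℝ) (x : Euc m) : Prop :=
  DifferentiableAt ℝ (moreauEnvelope (1 / (2 * ρ)) Φ) x ∧
    ‖gradient (moreauEnvelope (1 / (2 * ρ)) Φ) x‖ ≤ ε

/-- A (deterministic, adaptive) oracle method on the space `V` that makes `N` oracle calls: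
the `k`-th query is computed from the `k` answers received so far, and the output from all `N`
answers. The method has no other access to the problem instance behind the oracle. -/
structure OracleMethod (V : Type*) (N : ℕ) where
  query : (k : ℕ) → (Fin k → V) → V
  output : (Fin N → V) → V

namespace OracleMethod

/-- The first `k` answers received when the `j`-th query `v` is answered by `oracle j v`. -/
def answers {V : Type*} {N : ℕ} (A : OracleMethod V N) (oracle : ℕ → V → V) :
    (k : ℕ) → Fin k → V
  | 0 => Fin.elim0
  | k + 1 => Fin.snoc (α := fun _ => V) (A.answers oracle k)
      (oracle k (A.query k (A.answers oracle k)))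

/-- The output of the method after its `N` oracle calls. -/
def result {V : Type*} {N : ℕ} (A : OracleMethod V N) (oracle : ℕ → V → V) : V :=
  A.output (A.answers oracle N)

/-- All the maps that define the method are measurable. -/
def IsMeasurable {V : Type*} [MeasurableSpace V] {N : ℕ} (A : OracleMethod V N) : Prop :=
  (∀ k, Measurable (A.query k)) ∧ Measurable A.output

end OracleMethod

/-- `G(x, y, ξ)` with `ξ ∼ P` is a stochastic gradient of `f`: unbiased, with variance at most
`σ²` for the Euclidean norm on `ℝᵐ × ℝⁿ`. -/
structure IsStochasticGradient {m n : ℕ} {Ξ : Type*} [MeasurableSpace Ξ] (P : Measure Ξ) (σ : ℝ)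
    (f : Euc m → Euc n → ℝ) (G : Euc m × Euc n → Ξ → Euc m × Euc n) : Prop where
  measurable : Measurable (fun p : (Euc m × Euc n) × Ξ => G p.1 p.2)
  integrable : ∀ z, Integrable (G z) P
  unbiased : ∀ z, ∫ s, G z s ∂P = gradPair f z
  sq_integrable : ∀ z, Integrable
    (fun s => ‖(G z s).1 - gradX f z.1 z.2‖ ^ 2 + ‖(G z s).2 - gradY f z.1 z.2‖ ^ 2) P
  variance_le : ∀ z,
    ∫ s, (‖(G z s).1 - gradX f z.1 z.2‖ ^ 2 + ‖(G z s).2 - gradY f z.1 z.2‖ ^ 2) ∂P ≤ σ ^ 2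

/-!
Fix `a` and consider the prox-regularized game `f(x, y) + ℓ‖x - a‖²`, which is strongly convex in
`x` and concave in `y`. At a saddle point `(x, y)` of it, `x` is the proximal point of `Φ` at `a`
and `∇Φ_{1/2ℓ}(a) = 2ℓ(a - x)`, so stationarity of `a` for `Φ` says exactly that `a` is close to
`x`.

Given a stationary pair `(a, b)` of `f`, testing the strong convexity of the game at `a` and
bounding `Φ(a) - f(a, b⁺)` by the ascent step bounds `‖x - a‖`.

Conversely, at the saddle point `∇ₓf(x, y) = 2ℓ(a - x)` is already small, so it suffices to solve
the game approximately. The extragradient method started at `a` does this: the average of its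
iterates has small regret against the saddle point, and the average of the regularized gradients in
`x` telescopes to the total displacement divided by `ηT`. Both are controlled by one budget, the
squared initial distance plus accumulated noise, which independence of the samples bounds in
expectation; `η` and `T` are chosen so that each error is a fraction of `ε²`. When `ℓD < ε` no query
is needed: all points of `Y` are close enough to each other.
-/

section SmoothFunctions

variable {V : Type*} [NormedAddCommGroup V] [InnerProductSpace ℝ V] {g : V → ℝ} {v x x' a : V}

theorem convexOn_of_add_inner_le {s : Set V} {g' : V → V} (hs : Convex ℝ s)
    (h : ∀ x ∈ s, ∀ x' ∈ s, g x + inner ℝ (g' x) (x' - x) ≤ g x') : ConvexOn ℝ s g := by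
  refine ⟨hs, fun x hx x' hx' α β hα hβ hαβ => ?_⟩
  set z := α • x + β • x'
  have hz : z ∈ s := hs hx hx' hα hβ hαβ
  have hcancel : α * inner ℝ (g' z) (x - z) + β * inner ℝ (g' z) (x' - z) = 0 := by
    have hcomb : α • (x - z) + β • (x' - z) = 0 := by
      rw [smul_sub, smul_sub, sub_add_sub_comm, ← add_smul, hαβ, one_smul, sub_self]
    rw [← real_inner_smul_right, ← real_inner_smul_right, ← inner_add_right, hcomb,
      inner_zero_right]
  have hx_le := mul_le_mul_of_nonneg_left (h z hz x hx) hα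
  have hx'_le := mul_le_mul_of_nonneg_left (h z hz x' hx') hβ
  have hsplit : g z = α * g z + β * g z := by rw [← add_mul, hαβ, one_mul]
  simp only [smul_eq_mul]
  linarith

variable [CompleteSpace V]

theorem hasDerivAt_add_smul_of_hasGradientAt {t : ℝ} (h : HasGradientAt g v (x + t • x')) :
    HasDerivAt (fun s : ℝ => g (x + s • x')) (inner ℝ v x') t := by
  have hline : HasDerivAt (fun s : ℝ => x + s • x') x' t := by
    simpa using ((hasDerivAt_id t).smul_const x').const_add x
  simpa [Function.comp_def] using h.hasFDerivAt.comp_hasDerivAt t hline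

theorem hasGradientAt_of_abs_sub_le_sq {C : ℝ}
    (h : ∀ b, |g b - g a - inner ℝ v (b - a)| ≤ C * ‖b - a‖ ^ 2) : HasGradientAt g v a := by
  rw [hasGradientAt_iff_isLittleO]
  refine Asymptotics.IsBigO.trans_isLittleO (Asymptotics.IsBigO.of_bound C
    (Filter.Eventually.of_forall fun b => ?_)) (Asymptotics.isLittleO_pow_sub_sub a one_lt_two)
  simpa using h b

theorem concaveOn_le_add_inner_of_hasGradientAt {s : Set V} (hc : ConcaveOn ℝ s g)
    (hg : HasGradientAt g v x) (hx : x ∈ s) (hx' : x' ∈ s) :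
    g x' ≤ g x + inner ℝ v (x' - x) := by
  have hderiv : HasDerivAt (g ∘ AffineMap.lineMap x x') (inner ℝ v (x' - x)) (0 : ℝ) := by
    have h := hasDerivAt_add_smul_of_hasGradientAt (x := x) (x' := x' - x) (t := 0) (by simpa)
    simpa [Function.comp_def, AffineMap.lineMap_apply, add_comm] using h
  have hslope := (hc.comp_affineMap (AffineMap.lineMap x x')).slope_le_of_hasDerivAt
    (x := 0) (y := 1) (by simpa) (by simpa) one_pos hderiv
  simp only [slope_def_field, Function.comp_apply, AffineMap.lineMap_apply_one,
    AffineMap.lineMap_apply_zero, sub_zero, div_one] at hslope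
  linarith

end SmoothFunctions

namespace IsSmoothWith

variable {V : Type*} [NormedAddCommGroup V] [InnerProductSpace ℝ V] [CompleteSpace V]
  {ℓ : ℝ} {g : V → ℝ}

theorem hasGradientAt (h : IsSmoothWith ℓ g) (x : V) : HasGradientAt g (gradient g x) x :=
  (h.1 x).hasGradientAt

theorem neg (h : IsSmoothWith ℓ g) : IsSmoothWith ℓ (fun x => -g x) := by
  have hgrad : ∀ x, gradient (fun x => -g x) x = -gradient g x := fun x => by
    simp [gradient, fderiv_fun_neg]
  refine ⟨h.1.neg, fun x x' => ?_⟩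
  rw [hgrad, hgrad, neg_sub_neg, norm_sub_rev]
  exact h.2 x x'

theorem le_quadratic (h : IsSmoothWith ℓ g) (x x' : V) :
    g x' ≤ g x + inner ℝ (gradient g x) (x' - x) + ℓ / 2 * ‖x' - x‖ ^ 2 := by
  set v := x' - x with hv
  have hderiv : ∀ t : ℝ, HasDerivAt
      (fun s : ℝ => g (x + s • v) - s * inner ℝ (gradient g x) v - ℓ / 2 * ‖v‖ ^ 2 * s ^ 2)
      (inner ℝ (gradient g (x + t • v) - gradient g x) v - ℓ * t * ‖v‖ ^ 2) t := fun t => by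
    refine (((hasDerivAt_add_smul_of_hasGradientAt (h.hasGradientAt (x + t • v))).sub
      ((hasDerivAt_id t).mul_const _)).sub
      (((hasDerivAt_id t).pow 2).const_mul _)).congr_deriv ?_
    simp [inner_sub_left]
    ring
  have hnonpos : ∀ t : ℝ, 0 ≤ t →
      inner ℝ (gradient g (x + t • v) - gradient g x) v - ℓ * t * ‖v‖ ^ 2 ≤ 0 := fun t ht => by
    have hlip := h.2 (x + t • v) x
    rw [add_sub_cancel_left, norm_smul, Real.norm_of_nonneg ht] at hlip
    have hcs := real_inner_le_norm (gradient g (x + t • v) - gradient g x) v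
    nlinarith [norm_nonneg v]
  have hanti := antitoneOn_of_deriv_nonpos (convex_Icc (0 : ℝ) 1)
    (fun t _ => (hderiv t).continuousAt.continuousWithinAt)
    (fun t _ => (hderiv t).differentiableAt.differentiableWithinAt)
    (fun t ht => (hderiv t).deriv ▸ hnonpos t (interior_subset ht).1)
  have hends := hanti (Set.left_mem_Icc.2 zero_le_one) (Set.right_mem_Icc.2 zero_le_one) zero_le_one
  simp only [hv, one_smul, add_sub_cancel, one_mul, one_pow, mul_one, zero_smul, add_zero,
    zero_mul, sub_zero, zero_pow two_ne_zero, mul_zero] at hends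
  linarith

theorem quadratic_le (h : IsSmoothWith ℓ g) (x x' : V) :
    g x + inner ℝ (gradient g x) (x' - x) - ℓ / 2 * ‖x' - x‖ ^ 2 ≤ g x' := by
  have hneg := h.neg.le_quadratic x x'
  simp only [gradient, fderiv_fun_neg, map_neg, inner_neg_left] at hneg ⊢
  linarith

theorem add_sq_quadratic_le (h : IsSmoothWith ℓ g) (a x x' : V) :
    g x + ℓ * ‖x - a‖ ^ 2 + inner ℝ (gradient g x + (2 * ℓ) • (x - a)) (x' - x)
      + ℓ / 2 * ‖x' - x‖ ^ 2 ≤ g x' + ℓ * ‖x' - a‖ ^ 2 := by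
  have hsq : ‖x' - a‖ ^ 2 = ‖x - a‖ ^ 2 + 2 * inner ℝ (x - a) (x' - x) + ‖x' - x‖ ^ 2 := by
    rw [← norm_add_sq_real, add_comm, sub_add_sub_cancel]
  rw [inner_add_left, real_inner_smul_left, hsq]
  linarith [h.quadratic_le x x']

theorem add_sq_le_quadratic (h : IsSmoothWith ℓ g) (a x x' : V) :
    g x' + ℓ * ‖x' - a‖ ^ 2 ≤
      g x + ℓ * ‖x - a‖ ^ 2 + inner ℝ (gradient g x + (2 * ℓ) • (x - a)) (x' - x)
      + 3 * ℓ / 2 * ‖x' - x‖ ^ 2 := by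
  have hsq : ‖x' - a‖ ^ 2 = ‖x - a‖ ^ 2 + 2 * inner ℝ (x - a) (x' - x) + ‖x' - x‖ ^ 2 := by
    rw [← norm_add_sq_real, add_comm, sub_add_sub_cancel]
  rw [inner_add_left, real_inner_smul_left, hsq]
  linarith [h.le_quadratic x x']

theorem convexOn_add_sq (h : IsSmoothWith ℓ g) (hℓ : 0 ≤ ℓ) (a : V) :
    ConvexOn ℝ Set.univ fun x => g x + ℓ * ‖x - a‖ ^ 2 :=
  convexOn_of_add_inner_le convex_univ fun x _ x' _ =>
    (le_add_of_nonneg_right (by positivity)).trans (h.add_sq_quadratic_le a x x')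

theorem gradient_add_smul_eq_zero_of_forall_le (h : IsSmoothWith ℓ g) {a x : V}
    (hmin : ∀ x', g x + ℓ * ‖x - a‖ ^ 2 ≤ g x' + ℓ * ‖x' - a‖ ^ 2) :
    gradient g x + (2 * ℓ) • (x - a) = 0 := by
  have hgrad : HasGradientAt (fun x => g x + ℓ * ‖x - a‖ ^ 2)
      (gradient g x + (2 * ℓ) • (x - a)) x := by
    have hsq := (((hasFDerivAt_id x).sub_const a).norm_sq.const_mul ℓ)
    rw [hasGradientAt_iff_hasFDerivAt]
    refine ((h.hasGradientAt x).hasFDerivAt.add hsq).congr_fderiv ?_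
    ext v
    simp
    ring
  exact (InnerProductSpace.toDual ℝ V).map_eq_zero_iff.1
    (IsLocalMin.hasFDerivAt_eq_zero (Filter.Eventually.of_forall hmin) hgrad.hasFDerivAt)

end IsSmoothWith

namespace IsSmoothConcave

variable {m n : ℕ} {ℓ : ℝ} {Y : Set (Euc n)} {f : Euc m → Euc n → ℝ}

theorem hasGradientAt_left (h : IsSmoothConcave ℓ Y f) (x : Euc m) (y : Euc n) :
    HasGradientAt (fun x' => f x' y) (gradient (fun z : WithLp 2 (Euc m × Euc n) => f z.fst z.snd)
      (WithLp.toLp 2 (x, y))).fst x := by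
  have hjoint := (h.smooth.hasGradientAt (WithLp.toLp 2 (x, y))).hasFDerivAt
  have hincl := (WithLp.prodContinuousLinearEquiv 2 ℝ (Euc m) (Euc n)).symm.hasFDerivAt
    (x := (x, y))
  set p := gradient (fun z : WithLp 2 (Euc m × Euc n) => f z.fst z.snd) (WithLp.toLp 2 (x, y))
  rw [hasGradientAt_iff_hasFDerivAt]
  refine (hjoint.comp x (HasFDerivAt.comp (f := fun e => (e, y)) x hincl
    (hasFDerivAt_prodMk_left x y))).congr_fderiv ?_
  ext v
  simp [WithLp.prod_inner_apply]

theorem hasGradientAt_right (h : IsSmoothConcave ℓ Y f) (x : Euc m) (y : Euc n) :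
    HasGradientAt (f x) (gradient (fun z : WithLp 2 (Euc m × Euc n) => f z.fst z.snd)
      (WithLp.toLp 2 (x, y))).snd y := by
  have hjoint := (h.smooth.hasGradientAt (WithLp.toLp 2 (x, y))).hasFDerivAt
  have hincl := (WithLp.prodContinuousLinearEquiv 2 ℝ (Euc m) (Euc n)).symm.hasFDerivAt
    (x := (x, y))
  set p := gradient (fun z : WithLp 2 (Euc m × Euc n) => f z.fst z.snd) (WithLp.toLp 2 (x, y))
  rw [hasGradientAt_iff_hasFDerivAt]
  refine (hjoint.comp y (HasFDerivAt.comp (f := fun e => (x, e)) y hincl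
    (hasFDerivAt_prodMk_right x y))).congr_fderiv ?_
  ext v
  simp [WithLp.prod_inner_apply]

theorem gradient_toLp (h : IsSmoothConcave ℓ Y f) (x : Euc m) (y : Euc n) :
    gradient (fun z : WithLp 2 (Euc m × Euc n) => f z.fst z.snd) (WithLp.toLp 2 (x, y))
      = WithLp.toLp 2 (gradX f x y, gradY f x y) := by
  rw [gradX, gradY, (h.hasGradientAt_left x y).gradient, (h.hasGradientAt_right x y).gradient]
  rfl

theorem continuous_uncurry (h : IsSmoothConcave ℓ Y f) :
    Continuous fun z : Euc m × Euc n => f z.1 z.2 :=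
  (continuous_iff_continuousAt.2 fun z => (h.smooth.hasGradientAt z).continuousAt).comp
    (WithLp.prod_continuous_toLp 2 (Euc m) (Euc n))

theorem norm_toLp_grad_sub_le (h : IsSmoothConcave ℓ Y f) (x x' : Euc m) (y y' : Euc n) :
    ‖WithLp.toLp 2 (gradX f x y - gradX f x' y', gradY f x y - gradY f x' y')‖
      ≤ ℓ * ‖WithLp.toLp 2 (x - x', y - y')‖ := by
  have hlip := h.smooth.2 (WithLp.toLp 2 (x, y)) (WithLp.toLp 2 (x', y'))
  rwa [h.gradient_toLp, h.gradient_toLp, ← WithLp.toLp_sub, ← WithLp.toLp_sub] at hlip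

theorem isSmoothWith_left (h : IsSmoothConcave ℓ Y f) (y : Euc n) :
    IsSmoothWith ℓ fun x => f x y := by
  refine ⟨fun x => (h.hasGradientAt_left x y).differentiableAt, fun x x' => ?_⟩
  change ‖gradX f x y - gradX f x' y‖ ≤ ℓ * ‖x - x'‖
  have hlip := (WithLp.norm_fst_le _ _).trans (h.norm_toLp_grad_sub_le x x' y y)
  simpa [WithLp.prod_norm_eq_of_L2] using hlip

theorem isSmoothWith_right (h : IsSmoothConcave ℓ Y f) (x : Euc m) : IsSmoothWith ℓ (f x) := by
  refine ⟨fun y => (h.hasGradientAt_right x y).differentiableAt, fun y y' => ?_⟩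
  change ‖gradY f x y - gradY f x y'‖ ≤ ℓ * ‖y - y'‖
  have hlip := (WithLp.norm_snd_le _ _).trans (h.norm_toLp_grad_sub_le x x y y')
  simpa [WithLp.prod_norm_eq_of_L2] using hlip

theorem norm_gradX_sub_le_left (h : IsSmoothConcave ℓ Y f) (x x' : Euc m) (y : Euc n) :
    ‖gradX f x y - gradX f x' y‖ ≤ ℓ * ‖x - x'‖ :=
  (h.isSmoothWith_left y).2 x x'

theorem norm_gradX_sub_le_right (h : IsSmoothConcave ℓ Y f) (x : Euc m) (y y' : Euc n) :
    ‖gradX f x y - gradX f x y'‖ ≤ ℓ * ‖y - y'‖ := by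
  have hlip := (WithLp.norm_fst_le _ _).trans (h.norm_toLp_grad_sub_le x x y y')
  simpa [WithLp.prod_norm_eq_of_L2] using hlip

theorem norm_gradY_sub_le_left (h : IsSmoothConcave ℓ Y f) (x x' : Euc m) (y : Euc n) :
    ‖gradY f x y - gradY f x' y‖ ≤ ℓ * ‖x - x'‖ := by
  have hlip := (WithLp.norm_snd_le _ _).trans (h.norm_toLp_grad_sub_le x x' y y)
  simpa [WithLp.prod_norm_eq_of_L2] using hlip

theorem continuous_gradPair (h : IsSmoothConcave ℓ Y f) : Continuous (gradPair f) := by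
  have hgrad : Continuous (gradient fun z : WithLp 2 (Euc m × Euc n) => f z.fst z.snd) :=
    (LipschitzWith.of_dist_le_mul (K := ℓ.toNNReal) fun z z' => by
      rw [dist_eq_norm, dist_eq_norm]
      exact (h.smooth.2 z z').trans (by gcongr; exact Real.le_coe_toNNReal ℓ)).continuous
  have hcomp := (WithLp.prod_continuous_ofLp 2 _ _).comp
    (hgrad.comp (WithLp.prod_continuous_toLp 2 (Euc m) (Euc n)))
  refine hcomp.congr fun z => ?_
  simp [h.gradient_toLp, gradPair]

theorem continuous_gradX (h : IsSmoothConcave ℓ Y f) :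
    Continuous fun z : Euc m × Euc n => gradX f z.1 z.2 :=
  continuous_fst.comp h.continuous_gradPair

theorem continuous_gradY (h : IsSmoothConcave ℓ Y f) :
    Continuous fun z : Euc m × Euc n => gradY f z.1 z.2 :=
  continuous_snd.comp h.continuous_gradPair

theorem le_add_inner_gradY (h : IsSmoothConcave ℓ Y f) (x : Euc m) {y y' : Euc n} (hy : y ∈ Y)
    (hy' : y' ∈ Y) : f x y' ≤ f x y + inner ℝ (gradY f x y) (y' - y) :=
  concaveOn_le_add_inner_of_hasGradientAt (h.concave x)
    ((h.isSmoothWith_right x).hasGradientAt y) hy hy'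

end IsSmoothConcave

namespace IsConstraintSet

variable {n : ℕ} {D : ℝ} {Y : Set (Euc n)}

theorem norm_sub_le (hY : IsConstraintSet D Y) {y y' : Euc n} (hy : y ∈ Y) (hy' : y' ∈ Y) :
    ‖y - y'‖ ≤ D := by
  rw [← dist_eq_norm, ← hY.diam_eq]
  exact Metric.dist_le_diam_of_mem hY.bounded hy hy'

theorem diam_nonneg (hY : IsConstraintSet D Y) : 0 ≤ D :=
  hY.diam_eq ▸ Metric.diam_nonneg

theorem isCompact (hY : IsConstraintSet D Y) : IsCompact Y :=
  Metric.isCompact_of_isClosed_isBounded hY.closed hY.bounded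

theorem projSet_mem (hY : IsConstraintSet D Y) (z : Euc n) : projSet Y z ∈ Y :=
  (projSet_spec hY.nonempty hY.closed z).1

theorem inner_sub_projSet_le (hY : IsConstraintSet D Y) (z : Euc n) {q : Euc n} (hq : q ∈ Y) :
    inner ℝ (z - projSet Y z) (q - projSet Y z) ≤ 0 := by
  obtain ⟨hp, hmin⟩ := projSet_spec hY.nonempty hY.closed z
  have : Nonempty Y := ⟨⟨_, hp⟩⟩
  refine (norm_eq_iInf_iff_real_inner_le_zero hY.convex hp).1 ?_ q hq
  exact le_antisymm (le_ciInf fun w => hmin w w.2)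
    (ciInf_le ⟨0, Set.forall_mem_range.2 fun _ => norm_nonneg _⟩ (⟨_, hp⟩ : Y))

theorem norm_projSet_sub_le (hY : IsConstraintSet D Y) (z z' : Euc n) :
    ‖projSet Y z - projSet Y z'‖ ≤ ‖z - z'‖ := by
  have hz := hY.inner_sub_projSet_le z (hY.projSet_mem z')
  have hz' := hY.inner_sub_projSet_le z' (hY.projSet_mem z)
  set p := projSet Y z
  set p' := projSet Y z'
  have hmono : ‖p - p'‖ * ‖p - p'‖ ≤ ‖z - z'‖ * ‖p - p'‖ := calc
    ‖p - p'‖ * ‖p - p'‖ = inner ℝ (z - z') (p - p') + inner ℝ (z - p) (p' - p)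
        + inner ℝ (z' - p') (p - p') := by
      rw [← neg_sub p p', inner_neg_right, ← sub_eq_add_neg, ← inner_sub_left, ← inner_add_left,
        ← real_inner_self_eq_norm_mul_norm]
      congr 1
      abel
    _ ≤ inner ℝ (z - z') (p - p') := by linarith
    _ ≤ ‖z - z'‖ * ‖p - p'‖ := real_inner_le_norm _ _
  rcases (norm_nonneg (p - p')).eq_or_lt with hzero | hpos
  · exact hzero ▸ norm_nonneg _
  · exact le_of_mul_le_mul_right hmono hpos

theorem continuous_projSet (hY : IsConstraintSet D Y) : Continuous (projSet Y) :=
  (LipschitzWith.of_dist_le_mul (K := 1) fun z z' => by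
    simpa [dist_eq_norm] using hY.norm_projSet_sub_le z z').continuous

end IsConstraintSet

section Moreau

variable {m : ℕ} {ρ : ℝ} {Φ : Euc m → ℝ} {a x : Euc m}

theorem moreauEnvelope_eq_iInf (hρ : 0 < ρ) (Φ : Euc m → ℝ) (b : Euc m) :
    moreauEnvelope (1 / (2 * ρ)) Φ b = ⨅ w, (Φ w + ρ * ‖w - b‖ ^ 2) := by
  have hcoeff : 1 / (2 * (1 / (2 * ρ))) = ρ := by field_simp
  rw [moreauEnvelope, hcoeff]

theorem quadratic_le_of_quadratic_growth (hρ : 0 ≤ ρ)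
    (hgrowth : ∀ w, Φ x + ρ * ‖x - a‖ ^ 2 + ρ / 2 * ‖w - x‖ ^ 2 ≤ Φ w + ρ * ‖w - a‖ ^ 2)
    (b w : Euc m) :
    Φ x + ρ * ‖x - a‖ ^ 2 + 2 * ρ * inner ℝ (a - x) (b - a) - ρ * ‖b - a‖ ^ 2
      ≤ Φ w + ρ * ‖w - b‖ ^ 2 := by
  have hsq : ‖w - b‖ ^ 2 = ‖w - a‖ ^ 2 - 2 * inner ℝ (w - a) (b - a) + ‖b - a‖ ^ 2 := by
    rw [← norm_sub_sq_real, sub_sub_sub_cancel_right]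
  have hinner : inner ℝ (w - a) (b - a) = inner ℝ (w - x) (b - a) - inner ℝ (a - x) (b - a) := by
    rw [← inner_sub_left, sub_sub_sub_cancel_right]
  have hcs := real_inner_le_norm (w - x) (b - a)
  rw [hsq, hinner]
  nlinarith [hgrowth w, mul_nonneg hρ (sq_nonneg (‖w - x‖ - 2 * ‖b - a‖)),
    mul_le_mul_of_nonneg_left hcs hρ]

theorem hasGradientAt_moreauEnvelope_of_quadratic_growth (hρ : 0 < ρ)
    (hgrowth : ∀ w, Φ x + ρ * ‖x - a‖ ^ 2 + ρ / 2 * ‖w - x‖ ^ 2 ≤ Φ w + ρ * ‖w - a‖ ^ 2) :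
    HasGradientAt (moreauEnvelope (1 / (2 * ρ)) Φ) ((2 * ρ) • (a - x)) a := by
  set c := Φ x + ρ * ‖x - a‖ ^ 2
  have hlower := quadratic_le_of_quadratic_growth hρ.le hgrowth
  have hle : ∀ b, c + 2 * ρ * inner ℝ (a - x) (b - a) - ρ * ‖b - a‖ ^ 2
      ≤ moreauEnvelope (1 / (2 * ρ)) Φ b := fun b =>
    (le_ciInf (hlower b)).trans_eq (moreauEnvelope_eq_iInf hρ Φ b).symm
  have hge : ∀ b, moreauEnvelope (1 / (2 * ρ)) Φ b
      ≤ c + 2 * ρ * inner ℝ (a - x) (b - a) + ρ * ‖b - a‖ ^ 2 := fun b => by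
    have hx := ciInf_le ⟨_, Set.forall_mem_range.2 (hlower b)⟩ x
    have hsq : ‖x - b‖ ^ 2 = ‖x - a‖ ^ 2 + 2 * inner ℝ (a - x) (b - a) + ‖b - a‖ ^ 2 := by
      rw [norm_sub_rev x a, ← norm_add_sq_real, norm_sub_rev, add_comm (a - x), sub_add_sub_cancel]
    rw [hsq, ← moreauEnvelope_eq_iInf hρ] at hx
    linarith
  have hval : moreauEnvelope (1 / (2 * ρ)) Φ a = c :=
    le_antisymm (by simpa using hge a) (by simpa using hle a)
  refine hasGradientAt_of_abs_sub_le_sq (C := ρ) fun b => ?_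
  rw [hval, real_inner_smul_left, abs_le]
  constructor <;> linarith [hle b, hge b]

theorem isMoreauStationary_iff_of_quadratic_growth (hρ : 0 < ρ)
    (hgrowth : ∀ w, Φ x + ρ * ‖x - a‖ ^ 2 + ρ / 2 * ‖w - x‖ ^ 2 ≤ Φ w + ρ * ‖w - a‖ ^ 2)
    {ε : ℝ} : IsMoreauStationary ρ Φ ε a ↔ 2 * ρ * ‖x - a‖ ≤ ε := by
  have hg := hasGradientAt_moreauEnvelope_of_quadratic_growth hρ hgrowth
  rw [IsMoreauStationary, hg.gradient, norm_smul, Real.norm_of_nonneg (by positivity),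
    norm_sub_rev]
  exact and_iff_right hg.differentiableAt

end Moreau

/-- The gradient in `x` of the regularized objective `f (x, y) + ℓ ‖x - a‖²`. -/
noncomputable def regGradX {m n : ℕ} (ℓ : ℝ) (f : Euc m → Euc n → ℝ) (a x : Euc m) (y : Euc n) :
    Euc m :=
  gradX f x y + (2 * ℓ) • (x - a)

/-- `(x, y)` is a saddle point of `f (x, y) + ℓ ‖x - a‖²` on `ℝᵐ × Y`; its `x`-component is the
proximal point of `Φ` at `a`. The minimality in `x` is encoded by the first-order condition, to
which it is equivalent by convexity in `x`. -/
structure IsProxSaddle {m n : ℕ} (ℓ : ℝ) (Y : Set (Euc n)) (f : Euc m → Euc n → ℝ) (a : Euc m)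
    (x : Euc m) (y : Euc n) : Prop where
  mem : y ∈ Y
  regGradX_eq_zero : regGradX ℓ f a x y = 0
  le_max : ∀ y' ∈ Y, f x y' ≤ f x y

section Saddle

variable {m n : ℕ} {ℓ D : ℝ} {Y : Set (Euc n)} {f : Euc m → Euc n → ℝ}

namespace IsSmoothConcave

theorem exists_forall_lt_add_sq (h : IsSmoothConcave ℓ Y f) (hℓ : 0 < ℓ)
    (hY : IsConstraintSet D Y) (a : Euc m) :
    ∃ R, 0 ≤ R ∧ ∀ y ∈ Y, ∀ x, R < ‖x - a‖ → f a y < f x y + ℓ * ‖x - a‖ ^ 2 := by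
  obtain ⟨M, hM⟩ := hY.isCompact.exists_bound_of_continuousOn
    (h.continuous_gradX.comp (Continuous.prodMk_right a)).continuousOn
  obtain ⟨y₀, hy₀⟩ := hY.nonempty
  have hM₀ : 0 ≤ M := (norm_nonneg _).trans (hM y₀ hy₀)
  refine ⟨2 * M / ℓ, by positivity, fun y hy x hx => ?_⟩
  have hquad := (h.isSmoothWith_left y).add_sq_quadratic_le a a x
  rw [sub_self, norm_zero, smul_zero, add_zero] at hquad
  have hcs : -(M * ‖x - a‖) ≤ inner ℝ (gradX f a y) (x - a) :=
    (neg_le_neg (mul_le_mul_of_nonneg_right (hM y hy) (norm_nonneg _))).trans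
      (abs_le.1 (abs_real_inner_le_norm _ _)).1
  change f a y + ℓ * 0 ^ 2 + inner ℝ (gradX f a y) (x - a) + ℓ / 2 * ‖x - a‖ ^ 2 ≤ _ at hquad
  rw [div_lt_iff₀ hℓ] at hx
  have hpos : 0 < ‖x - a‖ := by
    by_contra! hle
    nlinarith
  nlinarith [mul_pos hpos (sub_pos.2 hx)]

/-- Sion's theorem needs a compact set of `x`: outside a large ball around `a` the regularized
objective exceeds its value at `a`, so restricting `x` to that ball loses nothing. -/
theorem exists_isProxSaddle (h : IsSmoothConcave ℓ Y f) (hℓ : 0 < ℓ) (hY : IsConstraintSet D Y)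
    (a : Euc m) : ∃ x y, IsProxSaddle ℓ Y f a x y := by
  obtain ⟨R, hR, hout⟩ := h.exists_forall_lt_add_sq hℓ hY a
  have ha : a ∈ Metric.closedBall a R := Metric.mem_closedBall_self hR
  have hcont : Continuous fun z : Euc m × Euc n => f z.1 z.2 + ℓ * ‖z.1 - a‖ ^ 2 := by
    have := h.continuous_uncurry
    fun_prop
  obtain ⟨x, hx, y, hy, hsaddle⟩ := Sion.exists_isSaddlePointOn
    (f := fun x y => f x y + ℓ * ‖x - a‖ ^ 2) ⟨a, ha⟩ (convex_closedBall a R)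
    (isCompact_closedBall a R)
    (fun y _ => (hcont.comp (Continuous.prodMk_left y)).lowerSemicontinuous.lowerSemicontinuousOn _)
    (fun y _ => (((h.isSmoothWith_left y).convexOn_add_sq hℓ.le a).subset (Set.subset_univ _)
      (convex_closedBall a R)).quasiconvexOn)
    hY.convex hY.nonempty hY.isCompact
    (fun x _ =>
      (hcont.comp (Continuous.prodMk_right x)).upperSemicontinuous.upperSemicontinuousOn _)
    (fun x _ => ((h.concave x).add_const _).quasiconcaveOn)
  have hmin : ∀ x', f x y + ℓ * ‖x - a‖ ^ 2 ≤ f x' y + ℓ * ‖x' - a‖ ^ 2 := fun x' => by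
    by_cases hx' : x' ∈ Metric.closedBall a R
    · exact hsaddle x' hx' y hy
    · rw [mem_closedBall_iff_norm, not_le] at hx'
      have hxa := hsaddle a ha y hy
      simp only [sub_self, norm_zero] at hxa
      linarith [hout y hy x' hx']
  exact ⟨x, y, hy, (h.isSmoothWith_left y).gradient_add_smul_eq_zero_of_forall_le hmin,
    fun y' hy' => le_of_add_le_add_right (hsaddle x hx y' hy')⟩

theorem le_maxFun (h : IsSmoothConcave ℓ Y f) (hY : IsConstraintSet D Y) (x : Euc m) {y : Euc n}
    (hy : y ∈ Y) : f x y ≤ maxFun Y f x := by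
  have hbdd : BddAbove (Set.range fun y : Y => f x y) := by
    rw [← Set.image_eq_range]
    exact hY.isCompact.bddAbove_image
      (h.continuous_uncurry.comp (Continuous.prodMk_right x)).continuousOn
  exact le_ciSup hbdd ⟨y, hy⟩

end IsSmoothConcave

theorem maxFun_le {x : Euc m} {c : ℝ} (hne : Y.Nonempty) (hc : ∀ y ∈ Y, f x y ≤ c) :
    maxFun Y f x ≤ c :=
  have := hne.to_subtype
  ciSup_le fun y => hc y y.2

namespace IsProxSaddle

variable {a x : Euc m} {y : Euc n}

theorem add_sq_le_left (hs : IsProxSaddle ℓ Y f a x y) (h : IsSmoothConcave ℓ Y f) (w : Euc m) :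
    f x y + ℓ * ‖x - a‖ ^ 2 + ℓ / 2 * ‖w - x‖ ^ 2 ≤ f w y + ℓ * ‖w - a‖ ^ 2 := by
  have hquad := (h.isSmoothWith_left y).add_sq_quadratic_le a x w
  have hcrit : gradient (fun x => f x y) x + (2 * ℓ) • (x - a) = 0 := hs.regGradX_eq_zero
  rwa [hcrit, inner_zero_left, add_zero] at hquad

theorem maxFun_add_sq_le (hs : IsProxSaddle ℓ Y f a x y) (h : IsSmoothConcave ℓ Y f)
    (hY : IsConstraintSet D Y) (w : Euc m) :
    maxFun Y f x + ℓ * ‖x - a‖ ^ 2 + ℓ / 2 * ‖w - x‖ ^ 2 ≤ maxFun Y f w + ℓ * ‖w - a‖ ^ 2 := by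
  linarith [hs.add_sq_le_left h w, h.le_maxFun hY w hs.mem, maxFun_le hY.nonempty hs.le_max]

theorem isMoreauStationary_iff (hs : IsProxSaddle ℓ Y f a x y) (h : IsSmoothConcave ℓ Y f)
    (hℓ : 0 < ℓ) (hY : IsConstraintSet D Y) {ε : ℝ} :
    IsMoreauStationary ℓ (maxFun Y f) ε a ↔ 2 * ℓ * ‖x - a‖ ≤ ε :=
  isMoreauStationary_iff_of_quadratic_growth hℓ (hs.maxFun_add_sq_le h hY)

end IsProxSaddle

namespace IsSmoothConcave

theorem add_sq_le_ascentStep (h : IsSmoothConcave ℓ Y f) (hℓ : 0 < ℓ)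
    (hY : IsConstraintSet D Y) (x : Euc m) {y y' : Euc n} (hy : y ∈ Y) (hy' : y' ∈ Y) :
    f x y' + ℓ / 2 * ‖ascentStep ℓ Y f x y - y‖ ^ 2 ≤
      f x (ascentStep ℓ Y f x y) + ℓ * inner ℝ (ascentStep ℓ Y f x y - y) (y' - y) := by
  have hproj := hY.inner_sub_projSet_le (y + (1 / ℓ) • gradY f x y) hy'
  change inner ℝ (y + (1 / ℓ) • gradY f x y - ascentStep ℓ Y f x y)
    (y' - ascentStep ℓ Y f x y) ≤ 0 at hproj
  set p := ascentStep ℓ Y f x y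
  have hexpand : ℓ * inner ℝ (y + (1 / ℓ) • gradY f x y - p) (y' - p)
      = inner ℝ (gradY f x y) (y' - y) - inner ℝ (gradY f x y) (p - y)
        - ℓ * (inner ℝ (p - y) (y' - y) - ‖p - y‖ ^ 2) := by
    have hstep : y + (1 / ℓ) • gradY f x y - p = (1 / ℓ) • gradY f x y - (p - y) := by abel
    rw [hstep, ← sub_sub_sub_cancel_right y' p y, inner_sub_left, real_inner_smul_left,
      inner_sub_right, inner_sub_right (p - y), real_inner_self_eq_norm_sq]
    field_simp
  have hconcave := h.le_add_inner_gradY x hy hy'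
  have hsmooth := (h.isSmoothWith_right x).quadratic_le y p
  change f x y + inner ℝ (gradY f x y) (p - y) - ℓ / 2 * ‖p - y‖ ^ 2 ≤ f x p at hsmooth
  linarith [mul_nonpos_of_nonneg_of_nonpos hℓ.le hproj]

theorem maxFun_le_ascentStep_add (h : IsSmoothConcave ℓ Y f) (hℓ : 0 < ℓ)
    (hY : IsConstraintSet D Y) (x : Euc m) {y : Euc n} (hy : y ∈ Y) :
    maxFun Y f x ≤ f x (ascentStep ℓ Y f x y) + ℓ * ‖ascentStep ℓ Y f x y - y‖ * D := by
  refine maxFun_le hY.nonempty fun y' hy' => ?_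
  have hascent := h.add_sq_le_ascentStep hℓ hY x hy hy'
  have hcs : inner ℝ (ascentStep ℓ Y f x y - y) (y' - y) ≤ ‖ascentStep ℓ Y f x y - y‖ * D :=
    (real_inner_le_norm _ _).trans
      (mul_le_mul_of_nonneg_left (hY.norm_sub_le hy' hy) (norm_nonneg _))
  have hsq : 0 ≤ ℓ / 2 * ‖ascentStep ℓ Y f x y - y‖ ^ 2 := by positivity
  linarith [mul_le_mul_of_nonneg_left hcs hℓ.le]

theorem sq_norm_sub_le_of_isProxSaddle (h : IsSmoothConcave ℓ Y f) (hY : IsConstraintSet D Y)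
    {a x : Euc m} {y p : Euc n} (hs : IsProxSaddle ℓ Y f a x y) (hp : p ∈ Y) :
    ℓ * ‖x - a‖ ^ 2 ≤ maxFun Y f a - f a p + ‖gradX f a p‖ * ‖x - a‖ := by
  have hgrowth := hs.maxFun_add_sq_le h hY a
  rw [norm_sub_rev a x, sub_self, norm_zero] at hgrowth
  have hsmooth := (h.isSmoothWith_left p).quadratic_le a x
  change f a p + inner ℝ (gradX f a p) (x - a) - ℓ / 2 * ‖x - a‖ ^ 2 ≤ f x p at hsmooth
  linarith [h.le_maxFun hY x hp, (abs_le.1 (abs_real_inner_le_norm (gradX f a p) (x - a))).1]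

theorem isMoreauStationary_of_isStationaryPair (h : IsSmoothConcave ℓ Y f) (hℓ : 0 < ℓ)
    (hY : IsConstraintSet D Y) {ε : ℝ} (hε : 0 ≤ ε) {a : Euc m} {b : Euc n}
    (hs : IsStationaryPair ℓ Y f (ε ^ 2 / max 1 (ℓ * D)) a b) :
    IsMoreauStationary ℓ (maxFun Y f) (4 * ε ^ 2 + 4 * ε) a := by
  obtain ⟨hb, hgrad, hstep⟩ := hs
  obtain ⟨x, y, hsaddle⟩ := h.exists_isProxSaddle hℓ hY a
  rw [hsaddle.isMoreauStationary_iff h hℓ hY]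
  have hmax := h.maxFun_le_ascentStep_add hℓ hY a hb
  have hp : ascentStep ℓ Y f a b ∈ Y := hY.projSet_mem _
  have hdist := h.sq_norm_sub_le_of_isProxSaddle hY hsaddle hp
  set δ := ε ^ 2 / max 1 (ℓ * D)
  have hδ : δ ≤ ε ^ 2 := div_le_self (sq_nonneg ε) (le_max_left _ _)
  have hδD : δ * (ℓ * D) ≤ ε ^ 2 := by
    rw [div_mul_eq_mul_div, div_le_iff₀ (by positivity)]
    exact mul_le_mul_of_nonneg_left (le_max_right _ _) (sq_nonneg ε)
  have hℓstep : ℓ * ‖ascentStep ℓ Y f a b - b‖ ≤ δ := by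
    rwa [le_div_iff₀ hℓ, mul_comm] at hstep
  have hquad : (2 * ℓ * ‖x - a‖) ^ 2 ≤ 4 * ε ^ 2 + 2 * ε ^ 2 * (2 * ℓ * ‖x - a‖) := by
    have hcore : ℓ * ‖x - a‖ ^ 2 ≤ δ * D + δ * ‖x - a‖ := by
      linarith [mul_le_mul_of_nonneg_right hℓstep hY.diam_nonneg,
        mul_le_mul_of_nonneg_right hgrad (norm_nonneg (x - a))]
    nlinarith [mul_le_mul_of_nonneg_left hcore hℓ.le,
      mul_le_mul_of_nonneg_right hδ (mul_nonneg hℓ.le (norm_nonneg (x - a)))]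
  by_contra! hlt
  nlinarith [sq_nonneg ε]

end IsSmoothConcave

end Saddle

/-- The average of the first `T` terms of the sequence `v`; it is `0` for `T = 0`. -/
noncomputable def timeAvg {E : Type*} [AddCommGroup E] [Module ℝ E] (T : ℕ) (v : ℕ → E) : E :=
  (T : ℝ)⁻¹ • ∑ k ∈ Finset.range T, v k

section TimeAvg

variable {E F : Type*} [AddCommGroup E] [Module ℝ E] [AddCommGroup F] [Module ℝ F] {T : ℕ}

theorem timeAvg_add (T : ℕ) (u v : ℕ → E) :
    timeAvg T (fun k => u k + v k) = timeAvg T u + timeAvg T v := by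
  simp only [timeAvg, Finset.sum_add_distrib, smul_add]

theorem timeAvg_sub (T : ℕ) (u v : ℕ → E) :
    timeAvg T (fun k => u k - v k) = timeAvg T u - timeAvg T v := by
  simp only [timeAvg, Finset.sum_sub_distrib, smul_sub]

theorem timeAvg_const (hT : 0 < T) (c : E) : timeAvg T (fun _ => c) = c := by
  rw [timeAvg, Finset.sum_const, Finset.card_range, ← Nat.cast_smul_eq_nsmul ℝ, smul_smul,
    inv_mul_cancel₀ (Nat.cast_ne_zero.2 hT.ne'), one_smul]

theorem map_timeAvg (φ : E →ₗ[ℝ] F) (T : ℕ) (v : ℕ → E) :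
    φ (timeAvg T v) = timeAvg T fun k => φ (v k) := by
  simp only [timeAvg, map_smul, map_sum]

theorem timeAvg_le_timeAvg {u v : ℕ → ℝ} (huv : ∀ k, u k ≤ v k) : timeAvg T u ≤ timeAvg T v :=
  smul_le_smul_of_nonneg_left (Finset.sum_le_sum fun k _ => huv k) (by positivity)

theorem timeAvg_nonneg {v : ℕ → ℝ} (hv : ∀ k, 0 ≤ v k) : 0 ≤ timeAvg T v :=
  smul_nonneg (by positivity) (Finset.sum_nonneg fun k _ => hv k)

theorem timeAvg_mem {s : Set E} (hs : Convex ℝ s) (hT : 0 < T) {v : ℕ → E} (hv : ∀ k, v k ∈ s) :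
    timeAvg T v ∈ s := by
  rw [timeAvg, Finset.smul_sum]
  exact hs.sum_mem (fun _ _ => by positivity) (by simp [hT.ne']) fun k _ => hv k

theorem timeAvg_le_of_concaveOn {s : Set E} {g : E → ℝ} (hg : ConcaveOn ℝ s g) (hT : 0 < T)
    {v : ℕ → E} (hv : ∀ k, v k ∈ s) : timeAvg T (fun k => g (v k)) ≤ g (timeAvg T v) := by
  rw [timeAvg, timeAvg, Finset.smul_sum, Finset.smul_sum]
  exact hg.le_map_sum (fun _ _ => by positivity) (by simp [hT.ne']) fun k _ => hv k

theorem sq_norm_timeAvg_le {E : Type*} [NormedAddCommGroup E] [NormedSpace ℝ E] (hT : 0 < T)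
    (v : ℕ → E) : ‖timeAvg T v‖ ^ 2 ≤ timeAvg T fun k => ‖v k‖ ^ 2 := by
  have hconvex : ConvexOn ℝ Set.univ fun x : E => ‖x‖ ^ 2 :=
    convexOn_univ_norm.pow (fun _ _ => norm_nonneg _) 2
  rw [timeAvg, timeAvg, Finset.smul_sum, Finset.smul_sum]
  exact hconvex.map_sum_le (fun _ _ => by positivity) (by simp [hT.ne']) fun k _ => Set.mem_univ _

theorem sq_norm_timeAvg_sub_le {E : Type*} [NormedAddCommGroup E] [NormedSpace ℝ E] (hT : 0 < T)
    (v : ℕ → E) (x : E) : ‖timeAvg T v - x‖ ^ 2 ≤ timeAvg T fun k => ‖v k - x‖ ^ 2 := by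
  simpa only [timeAvg_sub, timeAvg_const hT] using sq_norm_timeAvg_le hT fun k => v k - x

end TimeAvg

theorem norm_add_sq_le_two_mul {E : Type*} [SeminormedAddCommGroup E] (u v : E) :
    ‖u + v‖ ^ 2 ≤ 2 * (‖u‖ ^ 2 + ‖v‖ ^ 2) :=
  (pow_le_pow_left₀ (norm_nonneg _) (norm_add_le u v) 2).trans add_sq_le

section AveragedIterates

variable {m n : ℕ} {ℓ D : ℝ} {Y : Set (Euc n)} {f : Euc m → Euc n → ℝ} {a x : Euc m} {y : Euc n}
  {T : ℕ} {u : ℕ → Euc m} {v : ℕ → Euc n}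

namespace IsSmoothConcave

theorem norm_regGradX_sub_le (h : IsSmoothConcave ℓ Y f) (hℓ : 0 ≤ ℓ) (a x x' : Euc m)
    (y : Euc n) :
    ‖regGradX ℓ f a x y - regGradX ℓ f a x' y‖ ≤ 3 * ℓ * ‖x - x'‖ := by
  have hsplit : regGradX ℓ f a x y - regGradX ℓ f a x' y
      = (gradX f x y - gradX f x' y) + (2 * ℓ) • (x - x') := by
    simp only [regGradX, smul_sub]
    abel
  calc ‖regGradX ℓ f a x y - regGradX ℓ f a x' y‖
      ≤ ‖gradX f x y - gradX f x' y‖ + ‖(2 * ℓ) • (x - x')‖ := hsplit ▸ norm_add_le _ _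
    _ ≤ ℓ * ‖x - x'‖ + 2 * ℓ * ‖x - x'‖ := by
      rw [norm_smul, Real.norm_of_nonneg (by positivity)]
      gcongr
      exact h.norm_gradX_sub_le_left x x' y
    _ = 3 * ℓ * ‖x - x'‖ := by ring

theorem sub_timeAvg_le (h : IsSmoothConcave ℓ Y f) (hT : 0 < T) (hv : ∀ k, v k ∈ Y) (x : Euc m)
    (c : ℝ) :
    c - f x (timeAvg T v) ≤ timeAvg T fun k => c - f x (v k) := by
  rw [timeAvg_sub, timeAvg_const hT]
  exact sub_le_sub_left (timeAvg_le_of_concaveOn (h.concave x) hT hv) c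

theorem sq_norm_timeAvg_regGradX_le (h : IsSmoothConcave ℓ Y f) (hℓ : 0 ≤ ℓ) (hT : 0 < T)
    (a x : Euc m) (u : ℕ → Euc m) (v : ℕ → Euc n) :
    ‖timeAvg T fun k => regGradX ℓ f a x (v k)‖ ^ 2
      ≤ 2 * (‖timeAvg T fun k => regGradX ℓ f a (u k) (v k)‖ ^ 2
        + 9 * ℓ ^ 2 * timeAvg T fun k => ‖u k - x‖ ^ 2) := by
  have hdiff : ‖timeAvg T fun k => regGradX ℓ f a x (v k) - regGradX ℓ f a (u k) (v k)‖ ^ 2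
      ≤ 9 * ℓ ^ 2 * timeAvg T fun k => ‖u k - x‖ ^ 2 := by
    refine (sq_norm_timeAvg_le hT _).trans ?_
    rw [← smul_eq_mul, ← LinearMap.lsmul_apply, map_timeAvg]
    refine timeAvg_le_timeAvg fun k => ?_
    refine (pow_le_pow_left₀ (norm_nonneg _) (h.norm_regGradX_sub_le hℓ a x (u k) (v k)) 2).trans ?_
    rw [norm_sub_rev, LinearMap.lsmul_apply, smul_eq_mul]
    exact (by ring : (3 * ℓ * ‖u k - x‖) ^ 2 = 9 * ℓ ^ 2 * ‖u k - x‖ ^ 2).le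
  have hsplit := norm_add_sq_le_two_mul (timeAvg T fun k => regGradX ℓ f a (u k) (v k))
    (timeAvg T fun k => regGradX ℓ f a x (v k) - regGradX ℓ f a (u k) (v k))
  rw [← timeAvg_add] at hsplit
  simp only [add_sub_cancel] at hsplit
  linarith

theorem norm_gradX_le (h : IsSmoothConcave ℓ Y f) (hℓ : 0 ≤ ℓ) {ε : ℝ} (hε : 2 * ℓ * ‖x - a‖ ≤ ε)
    (x' : Euc m) (y₁ y₂ : Euc n) :
    ‖gradX f x' y₂‖ ≤ ε + ‖regGradX ℓ f a x y₁‖ + ℓ * ‖x' - x‖ + ℓ * ‖y₂ - y₁‖ := by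
  have hsplit : gradX f x' y₂ = (gradX f x' y₂ - gradX f x y₂) + (gradX f x y₂ - gradX f x y₁)
      + regGradX ℓ f a x y₁ - (2 * ℓ) • (x - a) := by
    rw [regGradX]
    abel
  calc ‖gradX f x' y₂‖
      ≤ ‖gradX f x' y₂ - gradX f x y₂‖ + ‖gradX f x y₂ - gradX f x y₁‖
        + ‖regGradX ℓ f a x y₁‖ + ‖(2 * ℓ) • (x - a)‖ := by
        conv_lhs => rw [hsplit]
        exact (norm_sub_le _ _).trans (add_le_add_left (norm_add₃_le ..) _)
    _ ≤ ℓ * ‖x' - x‖ + ℓ * ‖y₂ - y₁‖ + ‖regGradX ℓ f a x y₁‖ + ε := by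
        rw [norm_smul, Real.norm_of_nonneg (by positivity : 0 ≤ 2 * ℓ)]
        gcongr
        exacts [h.norm_gradX_sub_le_left x' x y₂, h.norm_gradX_sub_le_right x y₂ y₁]
    _ = ε + ‖regGradX ℓ f a x y₁‖ + ℓ * ‖x' - x‖ + ℓ * ‖y₂ - y₁‖ := by ring

end IsSmoothConcave

namespace IsProxSaddle

theorem sq_norm_ascentStep_sub_le (hs : IsProxSaddle ℓ Y f a x y) (h : IsSmoothConcave ℓ Y f)
    (hℓ : 0 < ℓ) (hY : IsConstraintSet D Y) (x' : Euc m) {y' : Euc n} (hy' : y' ∈ Y) :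
    ℓ ^ 2 * ‖ascentStep ℓ Y f x' y' - y'‖ ^ 2
      ≤ 4 * ℓ * (f x y - f x y') + 2 * ℓ ^ 2 * ‖x' - x‖ ^ 2 := by
  set p := ascentStep ℓ Y f x' y'
  set q := ascentStep ℓ Y f x y'
  have hgap : ℓ * ‖q - y'‖ ^ 2 ≤ 2 * (f x y - f x y') := by
    have hascent := h.add_sq_le_ascentStep hℓ hY x hy' hy'
    rw [sub_self, inner_zero_right] at hascent
    linarith [hs.le_max q (hY.projSet_mem _)]
  have hpq : ‖p - q‖ ≤ ‖x' - x‖ := by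
    refine (hY.norm_projSet_sub_le _ _).trans ?_
    rw [add_sub_add_left_eq_sub, ← smul_sub, norm_smul, Real.norm_of_nonneg (by positivity),
      one_div, inv_mul_le_iff₀ hℓ]
    exact h.norm_gradY_sub_le_left x' x y'
  have hsplit : ‖p - y'‖ ^ 2 ≤ 2 * (‖p - q‖ ^ 2 + ‖q - y'‖ ^ 2) := by
    simpa only [sub_add_sub_cancel] using norm_add_sq_le_two_mul (p - q) (q - y')
  nlinarith [mul_le_mul_of_nonneg_left hgap hℓ.le, mul_le_mul_of_nonneg_left hsplit (sq_nonneg ℓ),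
    mul_le_mul_of_nonneg_left (pow_le_pow_left₀ (norm_nonneg _) hpq 2) (sq_nonneg ℓ)]

/-- Sandwich `f (x + d, ·) + ℓ ‖x + d - a‖²` between its quadratic bounds in `d`: averaging the
lower ones over the points `v k`, using concavity and the upper one at their average, the two
affine parts can differ by no more than the average gap plus `ℓ ‖d‖²`. -/
theorem inner_timeAvg_regGradX_sub_le (hs : IsProxSaddle ℓ Y f a x y) (h : IsSmoothConcave ℓ Y f)
    (hY : IsConstraintSet D Y) (hT : 0 < T) (hv : ∀ k, v k ∈ Y) (d : Euc m) :
    inner ℝ (timeAvg T (fun k => regGradX ℓ f a x (v k)) - regGradX ℓ f a x (timeAvg T v)) d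
      ≤ timeAvg T (fun k => f x y - f x (v k)) + ℓ * ‖d‖ ^ 2 := by
  have hupper := (h.isSmoothWith_left (timeAvg T v)).add_sq_le_quadratic a x (x + d)
  have hlower := timeAvg_le_timeAvg (T := T) fun k =>
    (h.isSmoothWith_left (v k)).add_sq_quadratic_le a x (x + d)
  have hconcave := timeAvg_le_of_concaveOn (h.concave (x + d)) hT hv
  have hgap := hs.le_max _ (timeAvg_mem hY.convex hT hv)
  have hinner := map_timeAvg (innerSL ℝ d).toLinearMap T fun k => regGradX ℓ f a x (v k)
  simp only [ContinuousLinearMap.coe_coe, innerSL_apply_apply, real_inner_comm _ d] at hinner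
  simp only [add_sub_cancel_left, timeAvg_add, timeAvg_const hT] at hupper hlower
  rw [timeAvg_sub, timeAvg_const hT, inner_sub_left, hinner]
  simp only [regGradX, gradX] at *
  linarith

theorem sq_norm_timeAvg_regGradX_sub_le (hs : IsProxSaddle ℓ Y f a x y)
    (h : IsSmoothConcave ℓ Y f) (hℓ : 0 < ℓ) (hY : IsConstraintSet D Y) (hT : 0 < T)
    (hv : ∀ k, v k ∈ Y) :
    ‖timeAvg T (fun k => regGradX ℓ f a x (v k)) - regGradX ℓ f a x (timeAvg T v)‖ ^ 2
      ≤ 4 * ℓ * timeAvg T fun k => f x y - f x (v k) := by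
  set e := timeAvg T (fun k => regGradX ℓ f a x (v k)) - regGradX ℓ f a x (timeAvg T v) with he
  have hle := hs.inner_timeAvg_regGradX_sub_le h hY hT hv ((1 / (2 * ℓ)) • e)
  rw [← he, real_inner_smul_right, real_inner_self_eq_norm_sq, norm_smul, mul_pow,
    Real.norm_of_nonneg (by positivity)] at hle
  have hsq : 1 / (2 * ℓ) * ‖e‖ ^ 2 - ℓ * ((1 / (2 * ℓ)) ^ 2 * ‖e‖ ^ 2) = ‖e‖ ^ 2 / (4 * ℓ) := by
    field_simp
    ring
  rw [mul_comm (4 * ℓ), ← div_le_iff₀ (by positivity)]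
  linarith

theorem sq_norm_ascentStep_timeAvg_sub_le (hs : IsProxSaddle ℓ Y f a x y)
    (h : IsSmoothConcave ℓ Y f) (hℓ : 0 < ℓ) (hY : IsConstraintSet D Y) (hT : 0 < T)
    (u : ℕ → Euc m) (hv : ∀ k, v k ∈ Y) :
    ℓ ^ 2 * ‖ascentStep ℓ Y f (timeAvg T u) (timeAvg T v) - timeAvg T v‖ ^ 2
      ≤ 4 * ℓ * timeAvg T (fun k => f x y - f x (v k))
        + 2 * ℓ ^ 2 * timeAvg T fun k => ‖u k - x‖ ^ 2 := by
  refine (hs.sq_norm_ascentStep_sub_le h hℓ hY _ (timeAvg_mem hY.convex hT hv)).trans ?_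
  gcongr
  · exact h.sub_timeAvg_le hT hv x _
  · exact sq_norm_timeAvg_sub_le hT u x

theorem sq_norm_gradX_ascentStep_timeAvg_le (hs : IsProxSaddle ℓ Y f a x y)
    (h : IsSmoothConcave ℓ Y f) (hℓ : 0 < ℓ) (hY : IsConstraintSet D Y) {ε : ℝ}
    (hε : 2 * ℓ * ‖x - a‖ ≤ ε) (hT : 0 < T) (u : ℕ → Euc m) (hv : ∀ k, v k ∈ Y) :
    ‖gradX f (timeAvg T u) (ascentStep ℓ Y f (timeAvg T u) (timeAvg T v))‖ ^ 2
      ≤ 4 * (ε ^ 2 + 4 * ‖timeAvg T fun k => regGradX ℓ f a (u k) (v k)‖ ^ 2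
        + 39 * ℓ ^ 2 * timeAvg T (fun k => ‖u k - x‖ ^ 2)
        + 12 * ℓ * timeAvg T fun k => f x y - f x (v k)) := by
  have hnorm := h.norm_gradX_le hℓ.le hε (timeAvg T u) (timeAvg T v)
    (ascentStep ℓ Y f (timeAvg T u) (timeAvg T v))
  have hascent := hs.sq_norm_ascentStep_timeAvg_sub_le h hℓ hY hT u hv
  have hdist := mul_le_mul_of_nonneg_left (sq_norm_timeAvg_sub_le hT u x) (sq_nonneg ℓ)
  have hreg : ‖regGradX ℓ f a x (timeAvg T v)‖ ^ 2
      ≤ 2 * (‖timeAvg T fun k => regGradX ℓ f a x (v k)‖ ^ 2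
        + 4 * ℓ * timeAvg T fun k => f x y - f x (v k)) := by
    have hdiff := hs.sq_norm_timeAvg_regGradX_sub_le h hℓ hY hT hv
    rw [norm_sub_rev] at hdiff
    have hsplit := norm_add_sq_le_two_mul (timeAvg T fun k => regGradX ℓ f a x (v k))
      (regGradX ℓ f a x (timeAvg T v) - timeAvg T fun k => regGradX ℓ f a x (v k))
    rw [add_sub_cancel] at hsplit
    linarith
  have hregavg := h.sq_norm_timeAvg_regGradX_le hℓ.le hT a x u v
  have hfour : ∀ p q r s : ℝ, (p + q + r + s) ^ 2 ≤ 4 * (p ^ 2 + q ^ 2 + r ^ 2 + s ^ 2) :=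
    fun p q r s => by
      nlinarith [sq_nonneg (p - q), sq_nonneg (p - r), sq_nonneg (p - s), sq_nonneg (q - r),
        sq_nonneg (q - s), sq_nonneg (r - s)]
  refine (pow_le_pow_left₀ (norm_nonneg _) hnorm 2).trans ((hfour _ _ _ _).trans ?_)
  rw [mul_pow, mul_pow]
  linarith

end IsProxSaddle

end AveragedIterates

section Extragradient

variable {E : Type*} [NormedAddCommGroup E] [InnerProductSpace ℝ E] {η : ℝ} {S : Set E}

/-- `w` is the projection of `z - η • g` onto the convex set `S` (encoded by its variational
characterization): a projected gradient step of length `η` along `g`. -/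
def IsProjStep (η : ℝ) (S : Set E) (z g w : E) : Prop :=
  w ∈ S ∧ ∀ u ∈ S, inner ℝ (z - η • g - w) (u - w) ≤ 0

/-- The extragradient iteration on `S`: the midpoint `w k` is reached from `z k` by a step along
`g₁ k`, and `z (k + 1)` is reached, again from `z k`, by a step along `g₂ k`. -/
structure IsExtragradientRun (η : ℝ) (S : Set E) (z w g₁ g₂ : ℕ → E) : Prop where
  mid : ∀ k, IsProjStep η S (z k) (g₁ k) (w k)
  next : ∀ k, IsProjStep η S (z k) (g₂ k) (z (k + 1))

theorem inner_extragradient_step_le {z w z' u g₁ g₂ : E} (hw : IsProjStep η S z g₁ w)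
    (hz' : IsProjStep η S z g₂ z') (hu : u ∈ S) :
    2 * η * inner ℝ g₂ (w - u)
      ≤ ‖z - u‖ ^ 2 - ‖z' - u‖ ^ 2 - ‖w - z‖ ^ 2 + η ^ 2 * ‖g₂ - g₁‖ ^ 2 := by
  have hmid := hw.2 z' hz'.1
  have hnext := hz'.2 u hu
  obtain ⟨A, rfl⟩ : ∃ A, w = z + A := ⟨w - z, by abel⟩
  obtain ⟨B, rfl⟩ : ∃ B, z' = z + A + B := ⟨z' - (z + A), by abel⟩
  obtain ⟨C, rfl⟩ : ∃ C, u = z + A + B - C := ⟨z + A + B - u, by abel⟩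
  have hsq : 0 ≤ ‖B + η • (g₂ - g₁)‖ ^ 2 := sq_nonneg _
  rw [show z - η • g₁ - (z + A) = -(A + η • g₁) by abel, add_sub_cancel_left] at hmid
  rw [show z - η • g₂ - (z + A + B) = -(A + B + η • g₂) by abel, sub_sub_cancel_left,
    inner_neg_neg] at hnext
  rw [show z + A - (z + A + B - C) = C - B by abel, show z - (z + A + B - C) = C - (A + B) by abel,
    sub_sub_cancel, add_sub_cancel_left, norm_sub_sq_real, norm_add_sq_real]
  rw [norm_add_sq_real, norm_smul, mul_pow, Real.norm_eq_abs, sq_abs] at hsq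
  simp only [inner_add_left, inner_add_right, inner_sub_right, inner_neg_left, inner_smul_left,
    inner_smul_right, conj_trivial, real_inner_comm C A, real_inner_comm C B,
    real_inner_comm g₁ B, real_inner_comm g₂ B] at hmid hnext hsq ⊢
  linarith

theorem norm_add_add_sq_le_three_mul {E : Type*} [SeminormedAddCommGroup E] (u v w : E) :
    ‖u + v + w‖ ^ 2 ≤ 3 * (‖u‖ ^ 2 + ‖v‖ ^ 2 + ‖w‖ ^ 2) := by
  refine (pow_le_pow_left₀ (norm_nonneg _) norm_add₃_le 2).trans ?_
  linarith [sq_nonneg (‖u‖ - ‖v‖), sq_nonneg (‖u‖ - ‖w‖), sq_nonneg (‖v‖ - ‖w‖)]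

theorem inner_extragradient_step_le_of_lipschitz {F : E → E} {L : ℝ}
    (hF : ∀ v v', ‖F v - F v'‖ ≤ L * ‖v - v'‖) (hη : 3 * (η * L) ^ 2 ≤ 1) {z w z' u g₁ g₂ : E}
    (hw : IsProjStep η S z g₁ w) (hz' : IsProjStep η S z g₂ z') (hu : u ∈ S) :
    2 * η * inner ℝ g₂ (w - u)
      ≤ ‖z - u‖ ^ 2 - ‖z' - u‖ ^ 2 + 3 * η ^ 2 * (‖g₁ - F z‖ ^ 2 + ‖g₂ - F w‖ ^ 2) := by
  have hstep := inner_extragradient_step_le hw hz' hu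
  have hsplit := norm_add_add_sq_le_three_mul (F w - F z) (g₂ - F w) (F z - g₁)
  rw [show F w - F z + (g₂ - F w) + (F z - g₁) = g₂ - g₁ by abel, norm_sub_rev (F z)] at hsplit
  have hlip := pow_le_pow_left₀ (norm_nonneg _) (hF w z) 2
  nlinarith [mul_le_mul_of_nonneg_left hsplit (sq_nonneg η),
    mul_le_mul_of_nonneg_left hlip (sq_nonneg η),
    mul_le_mul_of_nonneg_right hη (sq_nonneg ‖w - z‖)]

/-- A bound on the accumulated regret of `T` extragradient steps relative to `u` with noise `e₁`
in the steps to the midpoints `w` and `e₂` in the main steps, when the distance of the starting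
point to `u` is `r`. -/
def regretBudget (η : ℝ) (T : ℕ) (r : ℝ) (u : E) (w e₁ e₂ : ℕ → E) : ℝ :=
  r ^ 2 + ∑ k ∈ Finset.range T,
    (3 * η ^ 2 * (‖e₁ k‖ ^ 2 + ‖e₂ k‖ ^ 2) - 2 * η * inner ℝ (e₂ k) (w k - u))

theorem IsExtragradientRun.regret_le {z w g₁ g₂ : ℕ → E} (hrun : IsExtragradientRun η S z w g₁ g₂)
    {F : E → E} {L : ℝ} (hF : ∀ v v', ‖F v - F v'‖ ≤ L * ‖v - v'‖) (hη : 3 * (η * L) ^ 2 ≤ 1)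
    {u : E} (hu : u ∈ S) (T : ℕ) :
    2 * η * ∑ k ∈ Finset.range T, inner ℝ (F (w k)) (w k - u) + ‖z T - u‖ ^ 2
      ≤ regretBudget η T ‖z 0 - u‖ u w (fun k => g₁ k - F (z k)) fun k => g₂ k - F (w k) := by
  induction T with
  | zero => simp [regretBudget]
  | succ T ih =>
    have hstep := inner_extragradient_step_le_of_lipschitz hF hη (hrun.mid T) (hrun.next T) hu
    rw [regretBudget] at ih ⊢
    rw [Finset.sum_range_succ, Finset.sum_range_succ, inner_sub_left]
    linarith

end Extragradient

section SaddleOperator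

variable {m n : ℕ} {ℓ D : ℝ} {Y : Set (Euc n)} {f : Euc m → Euc n → ℝ}

/-- The product `ℝᵐ × ℝⁿ` with its Euclidean norm. -/
abbrev EucProd (m n : ℕ) : Type := WithLp 2 (Euc m × Euc n)

/-- The estimate at `z` of the monotone operator `(x, y) ↦ (∇ₓ h, -∇_y h)` of the regularized
objective `h (x, y) = f (x, y) + ℓ ‖x - a‖²` that results from the estimate `g` of `∇f (z)`. -/
noncomputable def saddleDir (ℓ : ℝ) (a : Euc m) (z g : Euc m × Euc n) : EucProd m n :=
  WithLp.toLp 2 (g.1 + (2 * ℓ) • (z.1 - a), -g.2)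

/-- The monotone operator `(x, y) ↦ (∇ₓ h, -∇_y h)` of `h (x, y) = f (x, y) + ℓ ‖x - a‖²`. -/
noncomputable def saddleOp (ℓ : ℝ) (f : Euc m → Euc n → ℝ) (a : Euc m) (z : EucProd m n) :
    EucProd m n :=
  saddleDir ℓ a z.ofLp (gradPair f z.ofLp)

theorem IsSmoothConcave.norm_saddleOp_sub_le (h : IsSmoothConcave ℓ Y f) (hℓ : 0 ≤ ℓ) (a : Euc m)
    (z z' : EucProd m n) : ‖saddleOp ℓ f a z - saddleOp ℓ f a z'‖ ≤ 3 * ℓ * ‖z - z'‖ := by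
  have hgrad := h.norm_toLp_grad_sub_le z.fst z'.fst z.snd z'.snd
  have hsplit : saddleOp ℓ f a z - saddleOp ℓ f a z'
      = WithLp.toLp 2 (gradX f z.fst z.snd - gradX f z'.fst z'.snd,
          -(gradY f z.fst z.snd - gradY f z'.fst z'.snd))
        + (2 * ℓ) • WithLp.toLp 2 (z.fst - z'.fst, 0) := by
    refine congrArg (WithLp.toLp 2) (Prod.ext ?_ ?_)
    · simp [saddleOp, saddleDir, gradPair, add_sub_add_comm, ← smul_sub]
    · simp [saddleOp, saddleDir, gradPair, neg_add_eq_sub]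
  calc ‖saddleOp ℓ f a z - saddleOp ℓ f a z'‖
      ≤ ℓ * ‖z - z'‖ + (2 * ℓ) * ‖z - z'‖ := by
        rw [hsplit]
        refine (norm_add_le _ _).trans (add_le_add ?_ ?_)
        · simpa [WithLp.prod_norm_eq_of_L2, norm_sub_rev] using hgrad
        · rw [norm_smul, Real.norm_of_nonneg (by positivity)]
          gcongr
          simpa using WithLp.norm_fst_le _ (z - z')
    _ = 3 * ℓ * ‖z - z'‖ := by ring

theorem IsProxSaddle.gap_le_inner_saddleOp {a x : Euc m} {y : Euc n} (hs : IsProxSaddle ℓ Y f a x y)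
    (h : IsSmoothConcave ℓ Y f) {w : EucProd m n} (hw : w.snd ∈ Y) :
    ℓ * ‖w.fst - x‖ ^ 2 + (f x y - f x w.snd)
      ≤ inner ℝ (saddleOp ℓ f a w) (w - WithLp.toLp 2 (x, y)) := by
  have hx := (h.isSmoothWith_left w.snd).add_sq_quadratic_le a w.fst x
  have hx' := (h.isSmoothWith_left y).add_sq_quadratic_le a x w.fst
  have hy := h.le_add_inner_gradY w.fst hw hs.mem
  have hcrit : gradient (fun x => f x y) x + (2 * ℓ) • (x - a) = 0 := hs.regGradX_eq_zero
  rw [hcrit, inner_zero_left] at hx'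
  rw [← neg_sub w.fst x, inner_neg_right, norm_neg] at hx
  rw [← neg_sub w.snd y, inner_neg_right] at hy
  rw [WithLp.prod_inner_apply]
  simp only [saddleOp, saddleDir, gradPair, gradX, WithLp.ofLp_snd, WithLp.ofLp_fst,
    WithLp.ofLp_sub, Prod.fst_sub, Prod.snd_sub, inner_neg_left]
  linarith

/-- The contribution to `saddleDir` of the error of the estimate `g` of `∇f (z)`. -/
noncomputable def gradError (f : Euc m → Euc n → ℝ) (z g : Euc m × Euc n) : EucProd m n :=
  WithLp.toLp 2 (g.1 - gradX f z.1 z.2, -(g.2 - gradY f z.1 z.2))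

theorem saddleDir_sub_saddleOp (a : Euc m) (z g : Euc m × Euc n) :
    saddleDir ℓ a z g - saddleOp ℓ f a (WithLp.toLp 2 z) = gradError f z g := by
  rw [saddleOp, saddleDir, saddleDir, ← WithLp.toLp_sub, gradError]
  simp [gradPair, neg_add_eq_sub]

/-- A step of length `η` from `z` against the direction `d`, projected onto `ℝᵐ × Y`. -/
noncomputable def projStep (η : ℝ) (Y : Set (Euc n)) (z : Euc m × Euc n) (d : EucProd m n) :
    Euc m × Euc n :=
  (z.1 - η • d.fst, projSet Y (z.2 - η • d.snd))

theorem IsConstraintSet.isProjStep_projStep (hY : IsConstraintSet D Y) (η : ℝ)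
    (z : Euc m × Euc n) (d : EucProd m n) :
    IsProjStep η {u : EucProd m n | u.snd ∈ Y} (WithLp.toLp 2 z) d
      (WithLp.toLp 2 (projStep η Y z d)) := by
  refine ⟨hY.projSet_mem _, fun u hu => ?_⟩
  rw [WithLp.prod_inner_apply]
  simpa [projStep] using hY.inner_sub_projSet_le (z.2 - η • d.snd) hu

end SaddleOperator

section SaddleRun

variable {m n : ℕ}

/-- The run of the extragradient method on the regularized objective `f (x, y) + ℓ ‖x - a‖²`, where
`q j` is the `j`-th query and `g j` the answer to it: the queries of even index are the main
iterates, those of odd index the midpoints. -/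
structure IsSaddleRun (ℓ η : ℝ) (Y : Set (Euc n)) (a : Euc m) (q g : ℕ → Euc m × Euc n) :
    Prop where
  mid : ∀ k, q (2 * k + 1) = projStep η Y (q (2 * k)) (saddleDir ℓ a (q (2 * k)) (g (2 * k)))
  next : ∀ k, q (2 * (k + 1))
    = projStep η Y (q (2 * k)) (saddleDir ℓ a (q (2 * k + 1)) (g (2 * k + 1)))

/-- The regret budget of the first `T` extragradient steps relative to the point `s`. -/
noncomputable def runBudget (η : ℝ) (f : Euc m → Euc n → ℝ) (q g : ℕ → Euc m × Euc n) (T : ℕ)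
    (s : EucProd m n) : ℝ :=
  regretBudget η T ‖WithLp.toLp 2 (q 0) - s‖ s (fun k => WithLp.toLp 2 (q (2 * k + 1)))
    (fun k => gradError f (q (2 * k)) (g (2 * k)))
    fun k => gradError f (q (2 * k + 1)) (g (2 * k + 1))

variable {ℓ η D : ℝ} {Y : Set (Euc n)} {a : Euc m} {q g : ℕ → Euc m × Euc n}
  {f : Euc m → Euc n → ℝ}

namespace IsSaddleRun

theorem snd_mem (hrun : IsSaddleRun ℓ η Y a q g) (hY : IsConstraintSet D Y) (k : ℕ) :
    (q (2 * k + 1)).2 ∈ Y :=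
  hrun.mid k ▸ hY.projSet_mem _

theorem isExtragradientRun (hrun : IsSaddleRun ℓ η Y a q g) (hY : IsConstraintSet D Y) :
    IsExtragradientRun η {u : EucProd m n | u.snd ∈ Y} (fun k => WithLp.toLp 2 (q (2 * k)))
      (fun k => WithLp.toLp 2 (q (2 * k + 1)))
      (fun k => saddleDir ℓ a (q (2 * k)) (g (2 * k)))
      (fun k => saddleDir ℓ a (q (2 * k + 1)) (g (2 * k + 1))) where
  mid k := hrun.mid k ▸ hY.isProjStep_projStep η _ _
  next k := hrun.next k ▸ hY.isProjStep_projStep η _ _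

variable {x : Euc m} {y : Euc n} {T : ℕ}

theorem regret_le (hrun : IsSaddleRun ℓ η Y a q g) (hs : IsProxSaddle ℓ Y f a x y)
    (h : IsSmoothConcave ℓ Y f) (hℓ : 0 ≤ ℓ) (hY : IsConstraintSet D Y) (hη : 0 ≤ η)
    (hηℓ : 27 * (η * ℓ) ^ 2 ≤ 1) (T : ℕ) :
    2 * η * ∑ k ∈ Finset.range T,
        (ℓ * ‖(q (2 * k + 1)).1 - x‖ ^ 2 + (f x y - f x (q (2 * k + 1)).2))
      + ‖WithLp.toLp 2 (q (2 * T)) - WithLp.toLp 2 (x, y)‖ ^ 2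
      ≤ runBudget η f q g T (WithLp.toLp 2 (x, y)) := by
  have hregret := (hrun.isExtragradientRun hY).regret_le
    (h.norm_saddleOp_sub_le hℓ a) (by linarith) (u := WithLp.toLp 2 (x, y)) hs.mem T
  simp only [saddleDir_sub_saddleOp] at hregret
  refine le_trans ?_ hregret
  gcongr
  exact hs.gap_le_inner_saddleOp h (w := WithLp.toLp 2 (q _)) (hrun.snd_mem hY _)

theorem timeAvg_gap_le (hrun : IsSaddleRun ℓ η Y a q g) (hs : IsProxSaddle ℓ Y f a x y)
    (h : IsSmoothConcave ℓ Y f) (hℓ : 0 ≤ ℓ) (hY : IsConstraintSet D Y) (hη : 0 < η)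
    (hηℓ : 27 * (η * ℓ) ^ 2 ≤ 1) (hT : 0 < T) :
    ℓ * timeAvg T (fun k => ‖(q (2 * k + 1)).1 - x‖ ^ 2)
        + timeAvg T (fun k => f x y - f x (q (2 * k + 1)).2)
      ≤ runBudget η f q g T (WithLp.toLp 2 (x, y)) / (2 * (η * T)) := by
  have hregret := hrun.regret_le hs h hℓ hY hη.le hηℓ T
  have hT' : (0 : ℝ) < T := Nat.cast_pos.2 hT
  rw [le_div_iff₀ (by positivity)]
  refine le_trans (le_of_eq ?_) ((le_add_of_nonneg_right (sq_nonneg _)).trans hregret)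
  simp only [timeAvg, smul_eq_mul, Finset.sum_add_distrib, ← Finset.mul_sum]
  field_simp

theorem sum_saddleDir_fst (hrun : IsSaddleRun ℓ η Y a q g) (T : ℕ) :
    η • ∑ k ∈ Finset.range T, (saddleDir ℓ a (q (2 * k + 1)) (g (2 * k + 1))).fst
      = (q 0).1 - (q (2 * T)).1 := by
  induction T with
  | zero => simp
  | succ T ih =>
    rw [Finset.sum_range_succ, smul_add, ih, hrun.next T, projStep, sub_add]

theorem timeAvg_regGradX_eq (hrun : IsSaddleRun ℓ η Y a q g) (hη : η ≠ 0) (T : ℕ) :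
    (timeAvg T fun k => regGradX ℓ f a (q (2 * k + 1)).1 (q (2 * k + 1)).2)
      = (η * T)⁻¹ • ((q 0).1 - (q (2 * T)).1)
        - (timeAvg T fun k => gradError f (q (2 * k + 1)) (g (2 * k + 1))).fst := by
  have hfst := map_timeAvg (WithLp.fstₗ 2 ℝ (Euc m) (Euc n)) T fun k =>
    gradError f (q (2 * k + 1)) (g (2 * k + 1))
  rw [WithLp.fstₗ_apply] at hfst
  rw [← hrun.sum_saddleDir_fst T, smul_smul, mul_inv_rev, inv_mul_cancel_right₀ hη, ← timeAvg,
    hfst, ← timeAvg_sub]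
  congr 1
  funext k
  simp [saddleDir, gradError, regGradX, add_comm]

theorem sq_norm_timeAvg_regGradX_le (hrun : IsSaddleRun ℓ η Y a q g)
    (hs : IsProxSaddle ℓ Y f a x y) (h : IsSmoothConcave ℓ Y f) (hℓ : 0 ≤ ℓ)
    (hY : IsConstraintSet D Y) (hη : 0 < η) (hηℓ : 27 * (η * ℓ) ^ 2 ≤ 1) (hT : 0 < T) :
    ‖timeAvg T fun k => regGradX ℓ f a (q (2 * k + 1)).1 (q (2 * k + 1)).2‖ ^ 2
      ≤ 4 * (runBudget η f q g T (WithLp.toLp 2 (x, y))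
          + ‖WithLp.toLp 2 (q 0) - WithLp.toLp 2 (x, y)‖ ^ 2) / (η * T) ^ 2
        + 2 * ‖timeAvg T fun k => gradError f (q (2 * k + 1)) (g (2 * k + 1))‖ ^ 2 := by
  have hdist : ‖WithLp.toLp 2 (q (2 * T)) - WithLp.toLp 2 (x, y)‖ ^ 2
      ≤ runBudget η f q g T (WithLp.toLp 2 (x, y)) := by
    refine le_trans (le_add_of_nonneg_left ?_) (hrun.regret_le hs h hℓ hY hη.le hηℓ T)
    exact mul_nonneg (by positivity) (Finset.sum_nonneg fun k _ => add_nonneg (by positivity)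
      (sub_nonneg.2 (hs.le_max _ (hrun.snd_mem hY k))))
  have hdisp : ‖(q 0).1 - (q (2 * T)).1‖ ^ 2
      ≤ 2 * (‖WithLp.toLp 2 (q 0) - WithLp.toLp 2 (x, y)‖ ^ 2
        + ‖WithLp.toLp 2 (q (2 * T)) - WithLp.toLp 2 (x, y)‖ ^ 2) := by
    rw [norm_sub_rev (WithLp.toLp 2 (q (2 * T)))]
    refine le_trans ?_ (norm_add_sq_le_two_mul _ _)
    rw [sub_add_sub_cancel]
    exact pow_le_pow_left₀ (norm_nonneg _)
      (WithLp.norm_fst_le _ (WithLp.toLp 2 (q 0) - WithLp.toLp 2 (q (2 * T)))) 2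
  have herror := pow_le_pow_left₀ (norm_nonneg _) (WithLp.norm_fst_le _
    (timeAvg T fun k => gradError f (q (2 * k + 1)) (g (2 * k + 1)))) 2
  have hsplit := norm_add_sq_le_two_mul ((η * T)⁻¹ • ((q 0).1 - (q (2 * T)).1))
    (-(timeAvg T fun k => gradError f (q (2 * k + 1)) (g (2 * k + 1))).fst)
  rw [← sub_eq_add_neg, ← hrun.timeAvg_regGradX_eq hη.ne' T, norm_neg, norm_smul, mul_pow,
    norm_inv, inv_pow, Real.norm_of_nonneg (by positivity)] at hsplit
  have hscaled := mul_le_mul_of_nonneg_left (hdisp.trans (mul_le_mul_of_nonneg_left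
    (add_le_add_right hdist _) zero_le_two)) (inv_nonneg.2 (sq_nonneg (η * T)))
  rw [div_eq_inv_mul]
  linarith

theorem sq_norm_ascentStep_sub_le (hrun : IsSaddleRun ℓ η Y a q g) (hs : IsProxSaddle ℓ Y f a x y)
    (h : IsSmoothConcave ℓ Y f) (hℓ : 0 < ℓ) (hY : IsConstraintSet D Y) (hη : 0 < η)
    (hηℓ : 27 * (η * ℓ) ^ 2 ≤ 1) (hT : 0 < T) :
    ℓ ^ 2 * ‖ascentStep ℓ Y f (timeAvg T fun k => (q (2 * k + 1)).1)
        (timeAvg T fun k => (q (2 * k + 1)).2) - timeAvg T fun k => (q (2 * k + 1)).2‖ ^ 2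
      ≤ 2 * ℓ / (η * T) * runBudget η f q g T (WithLp.toLp 2 (x, y)) := by
  have hbound := hs.sq_norm_ascentStep_timeAvg_sub_le h hℓ hY hT (fun k => (q (2 * k + 1)).1)
    (hrun.snd_mem hY)
  have hgap := mul_le_mul_of_nonneg_left (hrun.timeAvg_gap_le hs h hℓ.le hY hη hηℓ hT)
    (by positivity : 0 ≤ 4 * ℓ)
  have hdist := mul_nonneg (sq_nonneg ℓ)
    (timeAvg_nonneg (T := T) fun k => sq_nonneg ‖(q (2 * k + 1)).1 - x‖)
  refine (hbound.trans ?_).trans (hgap.trans_eq ?_)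
  · linarith
  · field_simp
    ring

theorem sq_norm_gradX_ascentStep_le (hrun : IsSaddleRun ℓ η Y a q g)
    (hs : IsProxSaddle ℓ Y f a x y) (h : IsSmoothConcave ℓ Y f) (hℓ : 0 < ℓ)
    (hY : IsConstraintSet D Y) {ε : ℝ} (hε : 2 * ℓ * ‖x - a‖ ≤ ε) (hη : 0 < η)
    (hηℓ : 27 * (η * ℓ) ^ 2 ≤ 1) (hT : 0 < T) :
    ‖gradX f (timeAvg T fun k => (q (2 * k + 1)).1)
        (ascentStep ℓ Y f (timeAvg T fun k => (q (2 * k + 1)).1)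
          (timeAvg T fun k => (q (2 * k + 1)).2))‖ ^ 2
      ≤ 4 * (ε ^ 2 + 16 * (runBudget η f q g T (WithLp.toLp 2 (x, y))
            + ‖WithLp.toLp 2 (q 0) - WithLp.toLp 2 (x, y)‖ ^ 2) / (η * T) ^ 2
          + 8 * ‖timeAvg T fun k => gradError f (q (2 * k + 1)) (g (2 * k + 1))‖ ^ 2
          + 20 * ℓ / (η * T) * runBudget η f q g T (WithLp.toLp 2 (x, y))) := by
  have hbound := hs.sq_norm_gradX_ascentStep_timeAvg_le h hℓ hY hε hT
    (fun k => (q (2 * k + 1)).1) (hrun.snd_mem hY)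
  have hreg := hrun.sq_norm_timeAvg_regGradX_le hs h hℓ.le hY hη hηℓ hT
  have hgap := mul_le_mul_of_nonneg_left (hrun.timeAvg_gap_le hs h hℓ.le hY hη hηℓ hT)
    (by positivity : 0 ≤ 40 * ℓ)
  have hdist := mul_nonneg (sq_nonneg ℓ)
    (timeAvg_nonneg (T := T) fun k => sq_nonneg ‖(q (2 * k + 1)).1 - x‖)
  have hvalue := mul_nonneg hℓ.le (timeAvg_nonneg (T := T) fun k =>
    sub_nonneg.2 (hs.le_max _ (hrun.snd_mem hY k)))
  have hscale : 40 * ℓ * (runBudget η f q g T (WithLp.toLp 2 (x, y)) / (2 * (η * T)))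
      = 20 * ℓ / (η * T) * runBudget η f q g T (WithLp.toLp 2 (x, y)) := by
    field_simp
    ring
  rw [hscale] at hgap
  rw [mul_div_assoc] at hreg ⊢
  linarith

end IsSaddleRun

end SaddleRun

namespace OracleMethod

variable {V : Type*} {N : ℕ}

/-- The query that receives the `k`-th answer. -/
def queryAt (A : OracleMethod V N) (oracle : ℕ → V → V) (k : ℕ) : V :=
  A.query k (A.answers oracle k)

theorem answers_eq (A : OracleMethod V N) (oracle : ℕ → V → V) (k : ℕ) :
    A.answers oracle k = fun i : Fin k => oracle i (A.queryAt oracle i) := by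
  induction k with
  | zero => exact funext fun i => i.elim0
  | succ k ih =>
    funext i
    refine Fin.lastCases ?_ (fun i => ?_) i
    · simp [answers, queryAt]
    · simp [answers, ih]

end OracleMethod

section ExtragradientMethod

variable {m n N : ℕ}

/-- The `k`-th main iterate of the extragradient method on `f (x, y) + ℓ ‖x - z₀.1‖²` started at
`z₀` when its queries receive the answers `g 0, g 1, …`. -/
noncomputable def saddleIterate (ℓ η : ℝ) (Y : Set (Euc n)) (z₀ : Euc m × Euc n)
    (g : ℕ → Euc m × Euc n) : ℕ → Euc m × Euc n
  | 0 => z₀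
  | k + 1 =>
    let z := saddleIterate ℓ η Y z₀ g k
    let w := projStep η Y z (saddleDir ℓ z₀.1 z (g (2 * k)))
    projStep η Y z (saddleDir ℓ z₀.1 w (g (2 * k + 1)))

/-- The midpoint between the `k`-th main iterate and the next one. -/
noncomputable def saddleMidpoint (ℓ η : ℝ) (Y : Set (Euc n)) (z₀ : Euc m × Euc n)
    (g : ℕ → Euc m × Euc n) (k : ℕ) : Euc m × Euc n :=
  projStep η Y (saddleIterate ℓ η Y z₀ g k)
    (saddleDir ℓ z₀.1 (saddleIterate ℓ η Y z₀ g k) (g (2 * k)))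

/-- The `j`-th query of the extragradient method, alternately an iterate and a midpoint. -/
noncomputable def saddleQuery (ℓ η : ℝ) (Y : Set (Euc n)) (z₀ : Euc m × Euc n)
    (g : ℕ → Euc m × Euc n) (j : ℕ) : Euc m × Euc n :=
  if Even j then saddleIterate ℓ η Y z₀ g (j / 2) else saddleMidpoint ℓ η Y z₀ g (j / 2)

variable {ℓ η D : ℝ} {Y : Set (Euc n)} {z₀ : Euc m × Euc n} {g g' : ℕ → Euc m × Euc n}

theorem saddleQuery_even (k : ℕ) :
    saddleQuery ℓ η Y z₀ g (2 * k) = saddleIterate ℓ η Y z₀ g k := by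
  simp [saddleQuery]

theorem saddleQuery_odd (k : ℕ) :
    saddleQuery ℓ η Y z₀ g (2 * k + 1) = saddleMidpoint ℓ η Y z₀ g k := by
  rw [saddleQuery, if_neg (by simp), show (2 * k + 1) / 2 = k by lia]

theorem isSaddleRun_saddleQuery (ℓ η : ℝ) (Y : Set (Euc n)) (z₀ : Euc m × Euc n)
    (g : ℕ → Euc m × Euc n) : IsSaddleRun ℓ η Y z₀.1 (saddleQuery ℓ η Y z₀ g) g where
  mid k := by rw [saddleQuery_odd, saddleQuery_even, saddleMidpoint]
  next k := by
    rw [saddleQuery_odd, saddleQuery_even, saddleQuery_even, saddleIterate, saddleMidpoint]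

theorem saddleIterate_congr {k : ℕ} (hg : ∀ i < 2 * k, g i = g' i) :
    saddleIterate ℓ η Y z₀ g k = saddleIterate ℓ η Y z₀ g' k := by
  induction k with
  | zero => rfl
  | succ k ih =>
    rw [saddleIterate, saddleIterate, ih fun i hi => hg i (by lia), hg (2 * k) (by lia),
      hg (2 * k + 1) (by lia)]

theorem saddleQuery_congr {j : ℕ} (hg : ∀ i < j, g i = g' i) :
    saddleQuery ℓ η Y z₀ g j = saddleQuery ℓ η Y z₀ g' j := by
  obtain ⟨k, rfl | rfl⟩ := j.even_or_odd'
  · rw [saddleQuery_even, saddleQuery_even, saddleIterate_congr hg]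
  · rw [saddleQuery_odd, saddleQuery_odd, saddleMidpoint, saddleMidpoint,
      saddleIterate_congr fun i hi => hg i (by lia), hg (2 * k) (by lia)]

theorem measurable_saddleDir (ℓ : ℝ) (a : Euc m) :
    Measurable fun p : (Euc m × Euc n) × (Euc m × Euc n) => saddleDir ℓ a p.1 p.2 := by
  unfold saddleDir
  fun_prop

theorem IsConstraintSet.measurable_projStep (hY : IsConstraintSet D Y) (η : ℝ) :
    Measurable fun p : (Euc m × Euc n) × EucProd m n => projStep η Y p.1 p.2 := by
  have hproj := hY.continuous_projSet
  unfold projStep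
  fun_prop

theorem IsConstraintSet.measurable_saddleIterate (hY : IsConstraintSet D Y) (ℓ η : ℝ)
    (z₀ : Euc m × Euc n) (k : ℕ) : Measurable fun g => saddleIterate ℓ η Y z₀ g k := by
  induction k with
  | zero => exact measurable_const
  | succ k ih =>
    have hstep := hY.measurable_projStep (m := m) η
    have hdir := measurable_saddleDir (n := n) ℓ z₀.1
    exact hstep.comp (ih.prodMk (hdir.comp ((hstep.comp (ih.prodMk (hdir.comp
      (ih.prodMk (measurable_pi_apply _))))).prodMk (measurable_pi_apply _))))

theorem IsConstraintSet.measurable_saddleQuery (hY : IsConstraintSet D Y) (ℓ η : ℝ)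
    (z₀ : Euc m × Euc n) (j : ℕ) : Measurable fun g => saddleQuery ℓ η Y z₀ g j := by
  have hiter := hY.measurable_saddleIterate ℓ η z₀
  obtain ⟨k, rfl | rfl⟩ := j.even_or_odd'
  · simpa only [saddleQuery_even] using hiter k
  · simp only [saddleQuery_odd]
    exact (hY.measurable_projStep η).comp ((hiter k).prodMk ((measurable_saddleDir ℓ z₀.1).comp
      ((hiter k).prodMk (measurable_pi_apply _))))

/-- The sequence that starts with the entries of `v` and continues with zeros. -/
def extendByZero {V : Type*} [Zero V] {k : ℕ} (v : Fin k → V) (i : ℕ) : V :=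
  if h : i < k then v ⟨i, h⟩ else 0

theorem measurable_extendByZero {V : Type*} [Zero V] [MeasurableSpace V] (k : ℕ) :
    Measurable (extendByZero : (Fin k → V) → ℕ → V) := by
  refine measurable_pi_iff.2 fun i => ?_
  by_cases h : i < k
  · simpa only [extendByZero, h, dite_true] using measurable_pi_apply _
  · simpa only [extendByZero, h, dite_false] using measurable_const

/-- The oracle method that performs `T` extragradient steps and returns the average of the
midpoints. -/
noncomputable def saddleMethod (ℓ η : ℝ) (Y : Set (Euc n)) (z₀ : Euc m × Euc n) (T : ℕ) :
    OracleMethod (Euc m × Euc n) (2 * T) where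
  query k ans := saddleQuery ℓ η Y z₀ (extendByZero ans) k
  output ans := timeAvg T fun k => saddleQuery ℓ η Y z₀ (extendByZero ans) (2 * k + 1)

theorem IsConstraintSet.isMeasurable_saddleMethod (hY : IsConstraintSet D Y) (ℓ η : ℝ)
    (z₀ : Euc m × Euc n) (T : ℕ) : (saddleMethod ℓ η Y z₀ T).IsMeasurable := by
  refine ⟨fun k => (hY.measurable_saddleQuery ℓ η z₀ k).comp (measurable_extendByZero k), ?_⟩
  have hsum := Finset.measurable_fun_sum (Finset.range T) fun k _ =>
    (hY.measurable_saddleQuery ℓ η z₀ (2 * k + 1)).comp (measurable_extendByZero (2 * T))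
  exact hsum.const_smul (T : ℝ)⁻¹

theorem saddleQuery_extendByZero_answers (A : OracleMethod (Euc m × Euc n) N)
    (oracle : ℕ → Euc m × Euc n → Euc m × Euc n) {j k : ℕ} (hjk : j ≤ k) :
    saddleQuery ℓ η Y z₀ (extendByZero (A.answers oracle k)) j
      = saddleQuery ℓ η Y z₀ (fun i => oracle i (A.queryAt oracle i)) j := by
  refine saddleQuery_congr fun i hi => ?_
  simp only [extendByZero, hi.trans_le hjk, dite_true, OracleMethod.answers_eq]

theorem isSaddleRun_saddleMethod (ℓ η : ℝ) (Y : Set (Euc n)) (z₀ : Euc m × Euc n) (T : ℕ)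
    (oracle : ℕ → Euc m × Euc n → Euc m × Euc n) :
    IsSaddleRun ℓ η Y z₀.1 ((saddleMethod ℓ η Y z₀ T).queryAt oracle)
      fun j => oracle j ((saddleMethod ℓ η Y z₀ T).queryAt oracle j) := by
  convert isSaddleRun_saddleQuery ℓ η Y z₀
    fun j => oracle j ((saddleMethod ℓ η Y z₀ T).queryAt oracle j) using 1
  exact funext fun j => saddleQuery_extendByZero_answers _ oracle le_rfl

theorem saddleMethod_result (ℓ η : ℝ) (Y : Set (Euc n)) (z₀ : Euc m × Euc n) (T : ℕ)
    (oracle : ℕ → Euc m × Euc n → Euc m × Euc n) :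
    (saddleMethod ℓ η Y z₀ T).result oracle
      = timeAvg T fun k => (saddleMethod ℓ η Y z₀ T).queryAt oracle (2 * k + 1) := by
  refine congrArg ((T : ℝ)⁻¹ • ·) (Finset.sum_congr rfl fun k hk => ?_)
  have hk' := Finset.mem_range.1 hk
  exact (saddleQuery_extendByZero_answers _ oracle (by lia)).trans
    (saddleQuery_extendByZero_answers _ oracle le_rfl).symm

theorem saddleMethod_queryAt_zero (ℓ η : ℝ) (Y : Set (Euc n)) (z₀ : Euc m × Euc n) (T : ℕ)
    (oracle : ℕ → Euc m × Euc n → Euc m × Euc n) :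
    (saddleMethod ℓ η Y z₀ T).queryAt oracle 0 = z₀ :=
  saddleQuery_even (ℓ := ℓ) (η := η) (Y := Y) (g := extendByZero Fin.elim0) 0

end ExtragradientMethod

section Expectation

variable {Ω : Type*} [MeasurableSpace Ω] {μ : Measure Ω}

/-- The random variable `g` is integrable with expectation at most `c`. -/
def ExpectationLE (μ : Measure Ω) (g : Ω → ℝ) (c : ℝ) : Prop :=
  Integrable g μ ∧ ∫ ω, g ω ∂μ ≤ c

theorem expectationLE_const [IsProbabilityMeasure μ] (c : ℝ) : ExpectationLE μ (fun _ => c) c :=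
  ⟨integrable_const c, by simp⟩

namespace ExpectationLE

variable {g g' : Ω → ℝ} {c c' : ℝ}

theorem add (hg : ExpectationLE μ g c) (hg' : ExpectationLE μ g' c') :
    ExpectationLE μ (fun ω => g ω + g' ω) (c + c') :=
  ⟨hg.1.add hg'.1, (integral_add hg.1 hg'.1).trans_le (add_le_add hg.2 hg'.2)⟩

theorem const_mul (hg : ExpectationLE μ g c) {a : ℝ} (ha : 0 ≤ a) :
    ExpectationLE μ (fun ω => a * g ω) (a * c) :=
  ⟨hg.1.const_mul a, (integral_const_mul a g).trans_le (mul_le_mul_of_nonneg_left hg.2 ha)⟩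

theorem sum {g : ℕ → Ω → ℝ} (hg : ∀ k, ExpectationLE μ (g k) c) (T : ℕ) :
    ExpectationLE μ (fun ω => ∑ k ∈ Finset.range T, g k ω) (T * c) := by
  refine ⟨integrable_finsetSum _ fun k _ => (hg k).1, ?_⟩
  rw [integral_finsetSum _ fun k _ => (hg k).1]
  exact (Finset.sum_le_sum fun k _ => (hg k).2).trans_eq (by simp)

theorem mono (hg : ExpectationLE μ g c) (hm : AEStronglyMeasurable g' μ) (hnonneg : ∀ ω, 0 ≤ g' ω)
    (hle : ∀ ω, g' ω ≤ g ω) (hc : c ≤ c') : ExpectationLE μ g' c' := by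
  have hint : Integrable g' μ := hg.1.mono' hm (ae_of_all _ fun ω => by
    rw [Real.norm_of_nonneg (hnonneg ω)]
    exact hle ω)
  exact ⟨hint, (integral_mono hint hg.1 hle).trans (hg.2.trans hc)⟩

end ExpectationLE

variable {E : Type*} [NormedAddCommGroup E] [InnerProductSpace ℝ E] {c : ℝ}

theorem integrable_inner_of_memLp_two {u v : Ω → E} (hu : MemLp u 2 μ) (hv : MemLp v 2 μ) :
    Integrable (fun ω => inner ℝ (u ω) (v ω)) μ := by
  refine (hu.norm.integrable_mul hv.norm).mono (hu.1.inner hv.1) (ae_of_all _ fun ω => ?_)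
  simpa using abs_real_inner_le_norm (u ω) (v ω)

theorem expectationLE_sq_norm_sum {e : ℕ → Ω → E}
    (he : ∀ k, ExpectationLE μ (fun ω => ‖e k ω‖ ^ 2) c)
    (horth : ∀ k, ExpectationLE μ
      (fun ω => inner ℝ (e k ω) (∑ j ∈ Finset.range k, e j ω)) 0) (T : ℕ) :
    ExpectationLE μ (fun ω => ‖∑ k ∈ Finset.range T, e k ω‖ ^ 2) (T * c) := by
  induction T with
  | zero => simp [ExpectationLE]
  | succ T ih =>
    have hstep := (ih.add ((horth T).const_mul zero_le_two)).add (he T)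
    convert hstep using 1
    · funext ω
      rw [Finset.sum_range_succ, norm_add_sq_real, real_inner_comm]
    · push_cast
      ring

theorem expectationLE_sq_norm_timeAvg {e : ℕ → Ω → E}
    (he : ∀ k, ExpectationLE μ (fun ω => ‖e k ω‖ ^ 2) c)
    (horth : ∀ k, ExpectationLE μ
      (fun ω => inner ℝ (e k ω) (∑ j ∈ Finset.range k, e j ω)) 0) {T : ℕ} (hT : 0 < T) :
    ExpectationLE μ (fun ω => ‖timeAvg T fun k => e k ω‖ ^ 2) (c / T) := by
  have hscaled := (expectationLE_sq_norm_sum he horth T).const_mul (sq_nonneg (T : ℝ)⁻¹)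
  convert hscaled using 1
  · funext ω
    rw [timeAvg, norm_smul, mul_pow, Real.norm_of_nonneg (by positivity)]
  · field_simp

theorem expectationLE_regretBudget [IsProbabilityMeasure μ] {η : ℝ} (hη : 0 ≤ η) {u : E}
    {w e₁ e₂ : ℕ → Ω → E} (he₁ : ∀ k, ExpectationLE μ (fun ω => ‖e₁ k ω‖ ^ 2) c)
    (he₂ : ∀ k, ExpectationLE μ (fun ω => ‖e₂ k ω‖ ^ 2) c)
    (hw : ∀ k, ExpectationLE μ (fun ω => inner ℝ (e₂ k ω) (u - w k ω)) 0) (T : ℕ) (r : ℝ) :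
    ExpectationLE μ
      (fun ω => regretBudget η T r u (fun k => w k ω) (fun k => e₁ k ω) fun k => e₂ k ω)
      (r ^ 2 + 6 * η ^ 2 * T * c) := by
  have hsum := ExpectationLE.sum (fun k => (((he₁ k).add (he₂ k)).const_mul
    (by positivity : 0 ≤ 3 * η ^ 2)).add ((hw k).const_mul (by positivity : 0 ≤ 2 * η))) T
  convert (expectationLE_const (r ^ 2)).add hsum using 1
  · funext ω
    refine congrArg _ (Finset.sum_congr rfl fun k _ => ?_)
    rw [← neg_sub (w k ω) u, inner_neg_right, mul_neg, sub_eq_add_neg]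
  · ring

theorem IsProjStep.norm_sub_le {η : ℝ} {S : Set E} {z g w u : E} (hw : IsProjStep η S z g w)
    (hu : u ∈ S) : ‖w - u‖ ≤ ‖z - η • g - u‖ := by
  have hinner : inner ℝ (w - u) (w - u) ≤ inner ℝ (z - η • g - u) (w - u) := by
    rw [← sub_nonpos, ← inner_sub_left, ← neg_sub u w, inner_neg_right, ← inner_neg_left]
    convert hw.2 u hu using 2
    abel
  rw [real_inner_self_eq_norm_mul_norm] at hinner
  rcases (norm_nonneg (w - u)).eq_or_lt with hzero | hpos
  · exact hzero ▸ norm_nonneg _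
  · exact le_of_mul_le_mul_right (hinner.trans (real_inner_le_norm _ _)) hpos

theorem memLp_of_sub {E : Type*} [NormedAddCommGroup E] {p : ENNReal} {u v : Ω → E}
    (huv : MemLp (fun ω => u ω - v ω) p μ) (hv : MemLp v p μ) : MemLp u p μ :=
  sub_add_cancel u v ▸ huv.add hv

theorem memLp_two_of_isProjStep [IsFiniteMeasure μ] {η : ℝ} {S : Set E} {z g w : Ω → E} {u : E}
    (hz : MemLp z 2 μ) (hg : MemLp g 2 μ) (hwm : AEStronglyMeasurable w μ)
    (hw : ∀ ω, IsProjStep η S (z ω) (g ω) (w ω)) (hu : u ∈ S) : MemLp w 2 μ := by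
  have hsub : MemLp (fun ω => w ω - u) 2 μ :=
    ((hz.sub (hg.const_smul η)).sub (memLp_const u)).of_le (hwm.sub aestronglyMeasurable_const)
      (ae_of_all _ fun ω => (hw ω).norm_sub_le hu)
  exact memLp_of_sub hsub (memLp_const u)

theorem memLp_comp_of_lipschitz {E : Type*} [NormedAddCommGroup E] [IsFiniteMeasure μ]
    {p : ENNReal} {F : E → E} {L : ℝ} (hF : ∀ v v', ‖F v - F v'‖ ≤ L * ‖v - v'‖) {z : Ω → E}
    (hz : MemLp z p μ) : MemLp (fun ω => F (z ω)) p μ := by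
  have hlip : LipschitzWith L.toNNReal fun v => F v - F 0 :=
    LipschitzWith.of_dist_le' fun v v' => by simpa [dist_eq_norm] using hF v v'
  exact memLp_of_sub (hlip.comp_memLp (sub_self _) hz) (memLp_const (F 0))

theorem IsExtragradientRun.memLp_two_mid [IsFiniteMeasure μ] {η : ℝ} {S : Set E}
    {z w g₁ g₂ : Ω → ℕ → E} (hrun : ∀ ω, IsExtragradientRun η S (z ω) (w ω) (g₁ ω) (g₂ ω))
    {F : E → E} {L : ℝ} (hF : ∀ v v', ‖F v - F v'‖ ≤ L * ‖v - v'‖)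
    (hzm : ∀ k, AEStronglyMeasurable (fun ω => z ω k) μ)
    (hwm : ∀ k, AEStronglyMeasurable (fun ω => w ω k) μ)
    (he₁ : ∀ k, MemLp (fun ω => g₁ ω k - F (z ω k)) 2 μ)
    (he₂ : ∀ k, MemLp (fun ω => g₂ ω k - F (w ω k)) 2 μ)
    (hz₀ : MemLp (fun ω => z ω 0) 2 μ) {u : E} (hu : u ∈ S) (k : ℕ) :
    MemLp (fun ω => w ω k) 2 μ := by
  have hmid : ∀ k, MemLp (fun ω => z ω k) 2 μ → MemLp (fun ω => w ω k) 2 μ := fun k hz =>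
    memLp_two_of_isProjStep hz (memLp_of_sub (he₁ k) (memLp_comp_of_lipschitz hF hz))
      (hwm k) (fun ω => (hrun ω).mid k) hu
  have hmain : MemLp (fun ω => z ω k) 2 μ := by
    induction k with
    | zero => exact hz₀
    | succ k ih =>
      exact memLp_two_of_isProjStep ih
        (memLp_of_sub (he₂ k) (memLp_comp_of_lipschitz hF (hmid k ih))) (hzm (k + 1))
        (fun ω => (hrun ω).next k) hu
  exact hmid k hmain

end Expectation

section IndependentSamples

/-- The σ-algebra generated by the samples `ξ j` with `j < k`. -/
abbrev pastSamples {Ω Ξ : Type*} [MeasurableSpace Ξ] (ξ : ℕ → Ω → Ξ) (k : ℕ) :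
    MeasurableSpace Ω :=
  ⨆ j ∈ Set.Iio k, MeasurableSpace.comap (ξ j) inferInstance

theorem pastSamples_mono {Ω Ξ : Type*} [MeasurableSpace Ξ] (ξ : ℕ → Ω → Ξ) :
    Monotone (pastSamples ξ) :=
  fun _ _ hjk => biSup_mono fun _ hi => lt_of_lt_of_le hi hjk

theorem measurable_pastSamples {Ω Ξ : Type*} [MeasurableSpace Ξ] (ξ : ℕ → Ω → Ξ) {j k : ℕ}
    (hjk : j < k) : Measurable[pastSamples ξ k] (ξ j) :=
  measurable_iff_comap_le.2 (le_biSup (fun j => MeasurableSpace.comap (ξ j) inferInstance) hjk)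

theorem OracleMethod.IsMeasurable.measurable_queryAt {Ω Ξ V : Type*} [MeasurableSpace Ξ]
    [MeasurableSpace V] {N : ℕ} {A : OracleMethod V N} (hA : A.IsMeasurable) {G : V → Ξ → V}
    (hG : Measurable fun p : V × Ξ => G p.1 p.2) (ξ : ℕ → Ω → Ξ) (k : ℕ) :
    Measurable[pastSamples ξ k] fun ω => A.queryAt (fun j z => G z (ξ j ω)) k := by
  induction k using Nat.strong_induction_on with
  | _ k ih =>
    let _ : MeasurableSpace Ω := pastSamples ξ k
    have heq : (fun ω => A.queryAt (fun j z => G z (ξ j ω)) k) = fun ω =>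
        A.query k fun i : Fin k => G (A.queryAt (fun j z => G z (ξ j ω)) i) (ξ i ω) :=
      funext fun ω => congrArg (A.query k) (A.answers_eq _ k)
    rw [heq]
    refine (hA.1 k).comp (measurable_pi_lambda _ fun i => hG.comp (Measurable.prodMk ?_ ?_))
    · exact (ih i i.2).mono (pastSamples_mono ξ i.2.le) le_rfl
    · exact measurable_pastSamples ξ i.2

variable {Ω Ξ α : Type*} [MeasurableSpace Ω] [MeasurableSpace Ξ] [MeasurableSpace α]
  {μ : Measure Ω} {P : Measure Ξ}

/-- The samples `ξ 0, ξ 1, …` are independent and have law `P`. -/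
structure IsIIDSample (P : Measure Ξ) (μ : Measure Ω) (ξ : ℕ → Ω → Ξ) : Prop where
  measurable : ∀ k, Measurable (ξ k)
  map_eq : ∀ k, μ.map (ξ k) = P
  iIndepFun : iIndepFun ξ μ

theorem IsIIDSample.pastSamples_le {ξ : ℕ → Ω → Ξ} (hξ : IsIIDSample P μ ξ) (k : ℕ) :
    pastSamples ξ k ≤ (inferInstance : MeasurableSpace Ω) :=
  iSup₂_le fun j _ => (hξ.measurable j).comap_le

theorem IsIIDSample.indepFun_of_measurable_pastSamples {ξ : ℕ → Ω → Ξ} (hξ : IsIIDSample P μ ξ)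
    {k : ℕ} {X : Ω → α} (hX : Measurable[pastSamples ξ k] X) : IndepFun X (ξ k) μ := by
  have hindep := indep_iSup_of_disjoint (fun j => (hξ.measurable j).comap_le)
    ((iIndepFun_iff_iIndep _ ξ μ).1 hξ.iIndepFun)
    (Set.disjoint_singleton_right.2 (lt_irrefl k) : Disjoint (Set.Iio k) {k})
  rw [iSup_singleton] at hindep
  exact (IndepFun_iff_Indep X (ξ k) μ).2 (indep_of_indep_of_le_left hindep hX.comap_le)

theorem expectationLE_of_indepFun [IsProbabilityMeasure μ] {X : Ω → α} {ξ : Ω → Ξ}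
    (hX : Measurable X) (hξ : Measurable ξ) (hindep : IndepFun X ξ μ) {g : α × Ξ → ℝ}
    (hg : Measurable g) (hnonneg : ∀ p, 0 ≤ g p) {c : ℝ}
    (hc : ∀ a, ExpectationLE (μ.map ξ) (fun s => g (a, s)) c) :
    ExpectationLE μ (fun ω => g (X ω, ξ ω)) c := by
  have hmap := (indepFun_iff_map_prod_eq_prod_map_map hX.aemeasurable hξ.aemeasurable).1 hindep
  have : IsProbabilityMeasure (μ.map X) := Measure.isProbabilityMeasure_map hX.aemeasurable
  have hmeas : Measurable fun ω => (X ω, ξ ω) := hX.prodMk hξ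
  have hsm : AEStronglyMeasurable g ((μ.map X).prod (μ.map ξ)) := hg.aestronglyMeasurable
  have hint : Integrable g ((μ.map X).prod (μ.map ξ)) := by
    refine (integrable_prod_iff hsm).2 ⟨ae_of_all _ fun a => (hc a).1, ?_⟩
    refine Integrable.of_bound hsm.norm.integral_prod_right' c (ae_of_all _ fun a => ?_)
    rw [Real.norm_of_nonneg (integral_nonneg fun s => norm_nonneg _)]
    simpa only [Real.norm_of_nonneg (hnonneg _)] using (hc a).2
  refine ⟨(hmap ▸ hint).comp_measurable hmeas, ?_⟩
  calc ∫ ω, g (X ω, ξ ω) ∂μ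
      = ∫ p, g p ∂(μ.map X).prod (μ.map ξ) := by
        rw [← hmap, integral_map hmeas.aemeasurable hg.aestronglyMeasurable]
    _ = ∫ a, ∫ s, g (a, s) ∂μ.map ξ ∂μ.map X := integral_prod g hint
    _ ≤ ∫ _, c ∂μ.map X := integral_mono hint.integral_prod_left (integrable_const c)
        fun a => (hc a).2
    _ = c := by simp

theorem integral_inner_eq_zero_of_indepFun [IsFiniteMeasure μ] {E : Type*} [NormedAddCommGroup E]
    [InnerProductSpace ℝ E] [CompleteSpace E] [MeasurableSpace E] [BorelSpace E]
    [SecondCountableTopology E] {Q : Ω → α} {U : Ω → E} {ξ : Ω → Ξ}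
    (hQU : Measurable fun ω => (Q ω, U ω)) (hξ : Measurable ξ)
    (hindep : IndepFun (fun ω => (Q ω, U ω)) ξ μ) {N : α × Ξ → E} (hN : Measurable N)
    (hNint : ∀ a, Integrable (fun s => N (a, s)) (μ.map ξ))
    (hNzero : ∀ a, ∫ s, N (a, s) ∂μ.map ξ = 0)
    (hint : Integrable (fun ω => inner ℝ (N (Q ω, ξ ω)) (U ω)) μ) :
    ∫ ω, inner ℝ (N (Q ω, ξ ω)) (U ω) ∂μ = 0 := by
  have hmap := (indepFun_iff_map_prod_eq_prod_map_map hQU.aemeasurable hξ.aemeasurable).1 hindep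
  let φ : (α × E) × Ξ → ℝ := fun p => inner ℝ (N (p.1.1, p.2)) p.1.2
  have hφ : Measurable φ := (hN.comp (by fun_prop)).inner (by fun_prop)
  have hmeas : Measurable fun ω => ((Q ω, U ω), ξ ω) := hQU.prodMk hξ
  have hφint : Integrable φ ((μ.map fun ω => (Q ω, U ω)).prod (μ.map ξ)) := by
    rw [← hmap]
    exact (integrable_map_measure hφ.aestronglyMeasurable hmeas.aemeasurable).2 hint
  calc ∫ ω, inner ℝ (N (Q ω, ξ ω)) (U ω) ∂μ
      = ∫ p, φ p ∂(μ.map fun ω => (Q ω, U ω)).prod (μ.map ξ) := by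
        rw [← hmap, integral_map hmeas.aemeasurable hφ.aestronglyMeasurable]
    _ = ∫ x, ∫ s, φ (x, s) ∂μ.map ξ ∂(μ.map fun ω => (Q ω, U ω)) := integral_prod φ hφint
    _ = ∫ _ : α × E, (0 : ℝ) ∂(μ.map fun ω => (Q ω, U ω)) := by
        refine integral_congr_ae (ae_of_all _ fun x => ?_)
        simp only [φ, real_inner_comm x.2]
        rw [integral_inner (hNint x.1), hNzero, inner_zero_right]
    _ = 0 := integral_zero _ _

end IndependentSamples

section GradientNoise

variable {m n : ℕ} {ℓ : ℝ} {Y : Set (Euc n)} {f : Euc m → Euc n → ℝ}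

theorem sq_norm_gradError (z g : Euc m × Euc n) :
    ‖gradError f z g‖ ^ 2 = ‖g.1 - gradX f z.1 z.2‖ ^ 2 + ‖g.2 - gradY f z.1 z.2‖ ^ 2 := by
  simp [gradError, WithLp.prod_norm_sq_eq_of_L2, norm_sub_rev]

variable {Ξ : Type*} [MeasurableSpace Ξ] {P : Measure Ξ} {σ : ℝ}
  {G : Euc m × Euc n → Ξ → Euc m × Euc n}

namespace IsStochasticGradient

theorem measurable_gradError (hG : IsStochasticGradient P σ f G) (h : IsSmoothConcave ℓ Y f) :
    Measurable fun p : (Euc m × Euc n) × Ξ => gradError f p.1 (G p.1 p.2) := by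
  have hgrad := h.continuous_gradPair.measurable
  have hdiff := hG.measurable.sub (hgrad.comp measurable_fst)
  exact (WithLp.measurable_toLp 2 _).comp (hdiff.fst.prodMk hdiff.snd.neg)

theorem expectationLE_sq_norm_gradError (hG : IsStochasticGradient P σ f G)
    (z : Euc m × Euc n) : ExpectationLE P (fun s => ‖gradError f z (G z s)‖ ^ 2) (σ ^ 2) := by
  simp only [sq_norm_gradError]
  exact ⟨hG.sq_integrable z, hG.variance_le z⟩

theorem integrable_gradError [IsFiniteMeasure P] (hG : IsStochasticGradient P σ f G)
    (z : Euc m × Euc n) : Integrable (fun s => gradError f z (G z s)) P := by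
  have hdiff := (hG.integrable z).sub (integrable_const (gradPair f z))
  have hneg := hdiff.fst.prodMk hdiff.snd.neg
  exact (WithLp.prodContinuousLinearEquiv 2 ℝ (Euc m) (Euc n)).symm.toContinuousLinearMap
    |>.integrable_comp hneg

theorem integral_gradError_eq_zero [IsProbabilityMeasure P] (hG : IsStochasticGradient P σ f G)
    (z : Euc m × Euc n) : ∫ s, gradError f z (G z s) ∂P = 0 := by
  let L : Euc m × Euc n →L[ℝ] EucProd m n :=
    (WithLp.prodContinuousLinearEquiv 2 ℝ (Euc m) (Euc n)).symm.toContinuousLinearMap.comp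
      ((ContinuousLinearMap.id ℝ (Euc m)).prodMap (-ContinuousLinearMap.id ℝ (Euc n)))
  have hdiff := (hG.integrable z).sub (integrable_const (gradPair f z))
  calc ∫ s, gradError f z (G z s) ∂P = ∫ s, L (G z s - gradPair f z) ∂P := rfl
    _ = L (∫ s, (G z s - gradPair f z) ∂P) := L.integral_comp_comm hdiff
    _ = 0 := by simp [integral_sub (hG.integrable z), hG.unbiased]

end IsStochasticGradient

variable {Ω : Type*} {N : ℕ}

namespace OracleMethod

/-- The `k`-th query of `A` when the queries are answered by `G` with the samples `ξ`. -/
def randomQuery (A : OracleMethod (Euc m × Euc n) N) (G : Euc m × Euc n → Ξ → Euc m × Euc n)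
    (ξ : ℕ → Ω → Ξ) (k : ℕ) (ω : Ω) : Euc m × Euc n :=
  A.queryAt (fun j z => G z (ξ j ω)) k

/-- The error of the answer to the `k`-th query of `A`. -/
noncomputable def gradNoise (A : OracleMethod (Euc m × Euc n) N) (f : Euc m → Euc n → ℝ)
    (G : Euc m × Euc n → Ξ → Euc m × Euc n) (ξ : ℕ → Ω → Ξ) (k : ℕ) (ω : Ω) : EucProd m n :=
  gradError f (A.randomQuery G ξ k ω) (G (A.randomQuery G ξ k ω) (ξ k ω))

variable {A : OracleMethod (Euc m × Euc n) N} {ξ : ℕ → Ω → Ξ}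

theorem IsMeasurable.measurable_gradNoise (hA : A.IsMeasurable) (hG : IsStochasticGradient P σ f G)
    (h : IsSmoothConcave ℓ Y f) {j k : ℕ} (hjk : j < k) :
    Measurable[pastSamples ξ k] (A.gradNoise f G ξ j) := by
  let _ : MeasurableSpace Ω := pastSamples ξ k
  exact (hG.measurable_gradError h).comp
    (((hA.measurable_queryAt hG.measurable ξ j).mono (pastSamples_mono ξ hjk.le) le_rfl).prodMk
      (measurable_pastSamples ξ hjk))

variable [MeasurableSpace Ω] {μ : Measure Ω} [IsProbabilityMeasure μ]

theorem IsMeasurable.expectationLE_sq_norm_gradNoise (hA : A.IsMeasurable)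
    (hG : IsStochasticGradient P σ f G) (h : IsSmoothConcave ℓ Y f) (hξ : IsIIDSample P μ ξ)
    (k : ℕ) : ExpectationLE μ (fun ω => ‖A.gradNoise f G ξ k ω‖ ^ 2) (σ ^ 2) := by
  have hq := hA.measurable_queryAt hG.measurable ξ k
  refine expectationLE_of_indepFun (hq.mono (hξ.pastSamples_le k) le_rfl) (hξ.measurable k)
    (hξ.indepFun_of_measurable_pastSamples hq)
    ((hG.measurable_gradError h).norm.pow_const 2) (fun _ => sq_nonneg _) fun z => ?_
  exact hξ.map_eq k ▸ hG.expectationLE_sq_norm_gradError z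

theorem IsMeasurable.memLp_two_gradNoise (hA : A.IsMeasurable)
    (hG : IsStochasticGradient P σ f G) (h : IsSmoothConcave ℓ Y f) (hξ : IsIIDSample P μ ξ)
    (k : ℕ) : MemLp (A.gradNoise f G ξ k) 2 μ := by
  have hm := (hA.measurable_gradNoise (ξ := ξ) hG h k.lt_succ_self).mono
    (hξ.pastSamples_le (k + 1)) le_rfl
  exact (memLp_two_iff_integrable_sq_norm hm.aestronglyMeasurable).2
    (hA.expectationLE_sq_norm_gradNoise hG h hξ k).1

theorem IsMeasurable.expectationLE_inner_gradNoise (hA : A.IsMeasurable)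
    (hG : IsStochasticGradient P σ f G) (h : IsSmoothConcave ℓ Y f) (hξ : IsIIDSample P μ ξ)
    {k : ℕ} {U : Ω → EucProd m n} (hU : Measurable[pastSamples ξ k] U) (hU₂ : MemLp U 2 μ) :
    ExpectationLE μ (fun ω => inner ℝ (A.gradNoise f G ξ k ω) (U ω)) 0 := by
  have : IsProbabilityMeasure P :=
    hξ.map_eq k ▸ Measure.isProbabilityMeasure_map (hξ.measurable k).aemeasurable
  have hint := integrable_inner_of_memLp_two (hA.memLp_two_gradNoise hG h hξ k) hU₂
  have hqU := (hA.measurable_queryAt hG.measurable ξ k).prodMk hU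
  refine ⟨hint, (integral_inner_eq_zero_of_indepFun (hqU.mono (hξ.pastSamples_le k) le_rfl)
    (hξ.measurable k) (hξ.indepFun_of_measurable_pastSamples hqU) (hG.measurable_gradError h)
    ?_ ?_ hint).le⟩
  · exact hξ.map_eq k ▸ hG.integrable_gradError
  · exact hξ.map_eq k ▸ hG.integral_gradError_eq_zero

end OracleMethod

end GradientNoise

section StochasticExtragradient

variable {m n : ℕ} {ℓ η D σ ε : ℝ} {Y : Set (Euc n)} {f : Euc m → Euc n → ℝ} {T : ℕ}

theorem IsProxSaddle.sq_norm_toLp_sub_le {a x : Euc m} {y : Euc n} (hs : IsProxSaddle ℓ Y f a x y)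
    (hℓ : 0 < ℓ) (hY : IsConstraintSet D Y) (hx : 2 * ℓ * ‖x - a‖ ≤ ε) (hεD : ε ≤ ℓ * D)
    {y₀ : Euc n} (hy₀ : y₀ ∈ Y) :
    ‖WithLp.toLp 2 (a, y₀) - WithLp.toLp 2 (x, y)‖ ^ 2 ≤ 2 * D ^ 2 := by
  have hxD : ‖a - x‖ ≤ D := by
    rw [norm_sub_rev]
    refine le_of_mul_le_mul_left ?_ hℓ
    linarith [mul_nonneg hℓ.le (norm_nonneg (x - a))]
  have hsqx := pow_le_pow_left₀ (norm_nonneg _) hxD 2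
  have hsqy := pow_le_pow_left₀ (norm_nonneg _) (hY.norm_sub_le hy₀ hs.mem) 2
  rw [WithLp.prod_norm_sq_eq_of_L2]
  exact (add_le_add hsqx hsqy).trans_eq (two_mul _).symm

/-- A step length `η` and a number `T` of steps with which the stochastic extragradient method
reaches accuracy `ε` when the gradients have variance at most `σ ^ 2`. -/
structure IsStepSchedule (ℓ D σ ε η : ℝ) (T : ℕ) : Prop where
  step_pos : 0 < η
  steps_pos : 0 < T
  sq_step_mul_le : 27 * (η * ℓ) ^ 2 ≤ 1
  le_horizon : 1000 * (ℓ * D) ^ 2 ≤ η * T * (ℓ * ε ^ 2)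
  noise_le : η ^ 2 * T * σ ^ 2 ≤ 2 * D ^ 2
  le_steps : 10 ^ 6 * σ ^ 2 ≤ T * ε ^ 2

namespace IsStepSchedule

theorem div_mul_sq_le (hp : IsStepSchedule ℓ D σ ε η T) (hℓ : 0 < ℓ) :
    ℓ / (η * T) * D ^ 2 ≤ ε ^ 2 / 1000 := by
  have hη := hp.step_pos
  have hT : (0 : ℝ) < T := Nat.cast_pos.2 hp.steps_pos
  rw [div_mul_eq_mul_div, div_le_div_iff₀ (by positivity) (by norm_num)]
  refine le_of_mul_le_mul_left ?_ hℓ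
  linarith [hp.le_horizon]

theorem sq_div_sq_le (hp : IsStepSchedule ℓ D σ ε η T) (hℓ : 0 < ℓ) (hε : 0 < ε)
    (hεD : ε ≤ ℓ * D) : D ^ 2 / (η * T) ^ 2 ≤ ε ^ 2 / 10 ^ 6 := by
  have hη := hp.step_pos
  have hT : (0 : ℝ) < T := Nat.cast_pos.2 hp.steps_pos
  refine le_of_mul_le_mul_right ?_ (pow_pos hε 2)
  calc D ^ 2 / (η * T) ^ 2 * ε ^ 2 ≤ D ^ 2 / (η * T) ^ 2 * (ℓ * D) ^ 2 := by gcongr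
    _ = (ℓ / (η * T) * D ^ 2) ^ 2 := by ring
    _ ≤ (ε ^ 2 / 1000) ^ 2 := pow_le_pow_left₀ (by positivity) (hp.div_mul_sq_le hℓ) 2
    _ = ε ^ 2 / 10 ^ 6 * ε ^ 2 := by ring

theorem sq_div_le (hp : IsStepSchedule ℓ D σ ε η T) : σ ^ 2 / T ≤ ε ^ 2 / 10 ^ 6 := by
  rw [div_le_div_iff₀ (Nat.cast_pos.2 hp.steps_pos) (by norm_num)]
  linarith [hp.le_steps]

end IsStepSchedule

theorem IsConstraintSet.measurable_ascentStep (hY : IsConstraintSet D Y)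
    (h : IsSmoothConcave ℓ Y f) :
    Measurable fun z : Euc m × Euc n => ascentStep ℓ Y f z.1 z.2 :=
  hY.continuous_projSet.measurable.comp
    (measurable_snd.add (h.continuous_gradY.measurable.const_smul (1 / ℓ)))

variable {Ξ Ω : Type*} [MeasurableSpace Ξ] {P : Measure Ξ}
  {G : Euc m × Euc n → Ξ → Euc m × Euc n} {ξ : ℕ → Ω → Ξ}
  {N : ℕ} {A : OracleMethod (Euc m × Euc n) N} {z₀ : Euc m × Euc n}

namespace OracleMethod.IsMeasurable

theorem measurable_toLp_randomQuery (hA : A.IsMeasurable) (hG : IsStochasticGradient P σ f G)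
    (ξ : ℕ → Ω → Ξ) (k : ℕ) :
    Measurable[pastSamples ξ k] fun ω => WithLp.toLp 2 (A.randomQuery G ξ k ω) := by
  let _ : MeasurableSpace Ω := pastSamples ξ k
  exact (WithLp.measurable_toLp 2 _).comp (hA.measurable_queryAt hG.measurable ξ k)

variable [MeasurableSpace Ω] {μ : Measure Ω} [IsProbabilityMeasure μ]

theorem expectationLE_sq_norm_timeAvg_gradNoise (hA : A.IsMeasurable)
    (hG : IsStochasticGradient P σ f G) (h : IsSmoothConcave ℓ Y f) (hξ : IsIIDSample P μ ξ)
    (hT : 0 < T) :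
    ExpectationLE μ (fun ω => ‖timeAvg T fun k => A.gradNoise f G ξ (2 * k + 1) ω‖ ^ 2)
      (σ ^ 2 / T) := by
  refine expectationLE_sq_norm_timeAvg
    (fun k => hA.expectationLE_sq_norm_gradNoise hG h hξ (2 * k + 1))
    (fun k => hA.expectationLE_inner_gradNoise hG h hξ ?_ ?_) hT
  · exact Finset.measurable_fun_sum _ fun j hj =>
      hA.measurable_gradNoise hG h (by have := Finset.mem_range.1 hj; lia)
  · exact memLp_finsetSum _ fun j _ => hA.memLp_two_gradNoise hG h hξ (2 * j + 1)

theorem memLp_two_midpoint (hA : A.IsMeasurable) (hG : IsStochasticGradient P σ f G)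
    (h : IsSmoothConcave ℓ Y f) (hξ : IsIIDSample P μ ξ) (hℓ : 0 ≤ ℓ) (hY : IsConstraintSet D Y)
    {a : Euc m} (hrun : ∀ ω, IsSaddleRun ℓ η Y a (fun k => A.randomQuery G ξ k ω)
      fun k => G (A.randomQuery G ξ k ω) (ξ k ω))
    (hzero : ∀ ω, A.randomQuery G ξ 0 ω = z₀) (k : ℕ) :
    MemLp (fun ω => WithLp.toLp 2 (A.randomQuery G ξ (2 * k + 1) ω)) 2 μ := by
  obtain ⟨y, hy⟩ := hY.nonempty
  have hm : ∀ j, AEStronglyMeasurable (fun ω => WithLp.toLp 2 (A.randomQuery G ξ j ω)) μ :=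
    fun j => ((hA.measurable_toLp_randomQuery hG ξ j).mono
      (hξ.pastSamples_le j) le_rfl).aestronglyMeasurable
  refine IsExtragradientRun.memLp_two_mid (fun ω => (hrun ω).isExtragradientRun hY)
    (h.norm_saddleOp_sub_le hℓ a) (fun k => hm _) (fun k => hm _) (fun k => ?_) (fun k => ?_) ?_
    (u := WithLp.toLp 2 (a, y)) hy k
  · simp only [saddleDir_sub_saddleOp]
    exact hA.memLp_two_gradNoise hG h hξ (2 * k)
  · simp only [saddleDir_sub_saddleOp]
    exact hA.memLp_two_gradNoise hG h hξ (2 * k + 1)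
  · simpa only [mul_zero, hzero] using memLp_const _

theorem expectationLE_runBudget (hA : A.IsMeasurable) (hG : IsStochasticGradient P σ f G)
    (h : IsSmoothConcave ℓ Y f) (hξ : IsIIDSample P μ ξ) (hℓ : 0 ≤ ℓ) (hY : IsConstraintSet D Y)
    (hη : 0 ≤ η) {a : Euc m} (hrun : ∀ ω, IsSaddleRun ℓ η Y a (fun k => A.randomQuery G ξ k ω)
      fun k => G (A.randomQuery G ξ k ω) (ξ k ω))
    (hzero : ∀ ω, A.randomQuery G ξ 0 ω = z₀) (T : ℕ) (s : EucProd m n) :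
    ExpectationLE μ (fun ω => runBudget η f (fun k => A.randomQuery G ξ k ω)
        (fun k => G (A.randomQuery G ξ k ω) (ξ k ω)) T s)
      (‖WithLp.toLp 2 z₀ - s‖ ^ 2 + 6 * η ^ 2 * T * σ ^ 2) := by
  have hsq := hA.expectationLE_sq_norm_gradNoise hG h hξ
  simp only [runBudget, hzero]
  refine expectationLE_regretBudget hη (fun k => hsq (2 * k)) (fun k => hsq (2 * k + 1))
    (fun k => hA.expectationLE_inner_gradNoise hG h hξ ?_ ?_) T _
  · exact (hA.measurable_toLp_randomQuery hG ξ _).const_sub s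
  · exact (memLp_const s).sub (hA.memLp_two_midpoint hG h hξ hℓ hY hrun hzero k)

end OracleMethod.IsMeasurable

end StochasticExtragradient

section StochasticMethod

variable {m n : ℕ} {ℓ η D σ ε : ℝ} {Y : Set (Euc n)} {f : Euc m → Euc n → ℝ} {T : ℕ}
  {Ξ Ω : Type*} {G : Euc m × Euc n → Ξ → Euc m × Euc n} {ξ : ℕ → Ω → Ξ}

/-- The output of `A` when the queries are answered by `G` with the samples `ξ`. -/
def OracleMethod.randomResult {N : ℕ} (A : OracleMethod (Euc m × Euc n) N)
    (G : Euc m × Euc n → Ξ → Euc m × Euc n) (ξ : ℕ → Ω → Ξ) (ω : Ω) : Euc m × Euc n :=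
  A.result fun k z => G z (ξ k ω)

theorem randomResult_saddleMethod_fst (z₀ : Euc m × Euc n) (ω : Ω) :
    ((saddleMethod ℓ η Y z₀ T).randomResult G ξ ω).1
      = timeAvg T fun k => ((saddleMethod ℓ η Y z₀ T).randomQuery G ξ (2 * k + 1) ω).1 :=
  (congrArg Prod.fst (saddleMethod_result ..)).trans
    (map_timeAvg (LinearMap.fst ℝ (Euc m) (Euc n)) T _)

theorem randomResult_saddleMethod_snd (z₀ : Euc m × Euc n) (ω : Ω) :
    ((saddleMethod ℓ η Y z₀ T).randomResult G ξ ω).2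
      = timeAvg T fun k => ((saddleMethod ℓ η Y z₀ T).randomQuery G ξ (2 * k + 1) ω).2 :=
  (congrArg Prod.snd (saddleMethod_result ..)).trans
    (map_timeAvg (LinearMap.snd ℝ (Euc m) (Euc n)) T _)

variable [MeasurableSpace Ξ] {P : Measure Ξ} [MeasurableSpace Ω] {μ : Measure Ω}
  [IsProbabilityMeasure μ] {a x : Euc m} {y y₀ : Euc n}

theorem OracleMethod.IsMeasurable.measurable_randomResult {N : ℕ}
    {A : OracleMethod (Euc m × Euc n) N} (hA : A.IsMeasurable)
    (hG : Measurable fun p : (Euc m × Euc n) × Ξ => G p.1 p.2) (hξ : ∀ k, Measurable (ξ k)) :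
    Measurable (A.randomResult G ξ) := by
  have hq : ∀ k, Measurable (A.randomQuery G ξ k) := fun k =>
    (hA.measurable_queryAt hG ξ k).mono (iSup₂_le fun j _ => (hξ j).comap_le) le_rfl
  have heq : A.randomResult G ξ = fun ω =>
      A.output fun i : Fin N => G (A.randomQuery G ξ i ω) (ξ i ω) :=
    funext fun ω => congrArg A.output (A.answers_eq _ N)
  rw [heq]
  exact hA.2.comp (measurable_pi_lambda _ fun i => hG.comp ((hq i).prodMk (hξ i)))

theorem IsStepSchedule.expectationLE_runBudget (hp : IsStepSchedule ℓ D σ ε η T)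
    (hs : IsProxSaddle ℓ Y f a x y) (h : IsSmoothConcave ℓ Y f) (hℓ : 0 < ℓ)
    (hY : IsConstraintSet D Y) (hx : 2 * ℓ * ‖x - a‖ ≤ ε) (hεD : ε ≤ ℓ * D) (hy₀ : y₀ ∈ Y)
    (hG : IsStochasticGradient P σ f G) (hξ : IsIIDSample P μ ξ) :
    ExpectationLE μ
      (fun ω => runBudget η f (fun k => (saddleMethod ℓ η Y (a, y₀) T).randomQuery G ξ k ω)
        (fun k => G ((saddleMethod ℓ η Y (a, y₀) T).randomQuery G ξ k ω) (ξ k ω)) T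
        (WithLp.toLp 2 (x, y)))
      (14 * D ^ 2) := by
  obtain ⟨hint, hle⟩ := (hY.isMeasurable_saddleMethod ℓ η (a, y₀) T).expectationLE_runBudget hG h hξ
    hℓ.le hY hp.step_pos.le (fun ω => isSaddleRun_saddleMethod ℓ η Y (a, y₀) T _)
    (fun ω => saddleMethod_queryAt_zero ℓ η Y (a, y₀) T _) T (WithLp.toLp 2 (x, y))
  refine ⟨hint, hle.trans ?_⟩
  linarith [hs.sq_norm_toLp_sub_le hℓ hY hx hεD hy₀, hp.noise_le]

theorem IsStepSchedule.expectationLE_sq_norm_ascentStep_sub (hp : IsStepSchedule ℓ D σ ε η T)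
    (hs : IsProxSaddle ℓ Y f a x y) (h : IsSmoothConcave ℓ Y f) (hℓ : 0 < ℓ)
    (hY : IsConstraintSet D Y) (hx : 2 * ℓ * ‖x - a‖ ≤ ε) (hεD : ε ≤ ℓ * D) (hy₀ : y₀ ∈ Y)
    (hG : IsStochasticGradient P σ f G) (hξ : IsIIDSample P μ ξ) {z : Ω → Euc m × Euc n}
    (hz : z = (saddleMethod ℓ η Y (a, y₀) T).randomResult G ξ) :
    ExpectationLE μ (fun ω => ‖ascentStep ℓ Y f (z ω).1 (z ω).2 - (z ω).2‖ ^ 2)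
      ((4 * ε / ℓ) ^ 2) := by
  have hη := hp.step_pos
  have hzm : Measurable z := hz ▸
    (hY.isMeasurable_saddleMethod ℓ η (a, y₀) T).measurable_randomResult hG.measurable hξ.measurable
  have hbudget := hp.expectationLE_runBudget hs h hℓ hY hx hεD hy₀ hG hξ
  refine (hbudget.const_mul (by positivity : 0 ≤ 2 * ℓ / (η * T) / ℓ ^ 2)).mono
    ((((hY.measurable_ascentStep h).comp hzm).sub hzm.snd).norm.pow_const 2).aestronglyMeasurable
    (fun _ => sq_nonneg _) (fun ω => ?_) ?_
  · rw [hz, randomResult_saddleMethod_fst, randomResult_saddleMethod_snd, div_mul_eq_mul_div,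
      le_div_iff₀' (by positivity)]
    exact (isSaddleRun_saddleMethod ℓ η Y (a, y₀) T _).sq_norm_ascentStep_sub_le hs h hℓ hY hη
      hp.sq_step_mul_le hp.steps_pos
  · rw [div_mul_eq_mul_div, div_pow]
    gcongr
    linarith [hp.div_mul_sq_le hℓ, sq_nonneg ε,
      (by ring : 2 * ℓ / (η * T) * (14 * D ^ 2) = 28 * (ℓ / (η * T) * D ^ 2))]

theorem IsStepSchedule.expectationLE_sq_norm_gradX_ascentStep (hp : IsStepSchedule ℓ D σ ε η T)
    (hs : IsProxSaddle ℓ Y f a x y) (h : IsSmoothConcave ℓ Y f) (hℓ : 0 < ℓ)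
    (hY : IsConstraintSet D Y) (hx : 2 * ℓ * ‖x - a‖ ≤ ε) (hε : 0 < ε) (hεD : ε ≤ ℓ * D)
    (hy₀ : y₀ ∈ Y) (hG : IsStochasticGradient P σ f G) (hξ : IsIIDSample P μ ξ)
    {z : Ω → Euc m × Euc n} (hz : z = (saddleMethod ℓ η Y (a, y₀) T).randomResult G ξ) :
    ExpectationLE μ (fun ω => ‖gradX f (z ω).1 (ascentStep ℓ Y f (z ω).1 (z ω).2)‖ ^ 2)
      ((4 * ε) ^ 2) := by
  have hη := hp.step_pos
  have hA := hY.isMeasurable_saddleMethod ℓ η (a, y₀) T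
  have hzm : Measurable z := hz ▸ hA.measurable_randomResult hG.measurable hξ.measurable
  have hstep := (hY.measurable_ascentStep h).comp hzm
  have hbudget := hp.expectationLE_runBudget hs h hℓ hY hx hεD hy₀ hG hξ
  have hnoise := hA.expectationLE_sq_norm_timeAvg_gradNoise hG h hξ hp.steps_pos
  have hdisplacement := (hbudget.add
    (expectationLE_const (‖WithLp.toLp 2 (a, y₀) - WithLp.toLp 2 (x, y)‖ ^ 2))).const_mul
    (by positivity : 0 ≤ 16 / (η * T) ^ 2)
  refine (((((expectationLE_const (ε ^ 2)).add hdisplacement).add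
    (hnoise.const_mul (by norm_num : (0 : ℝ) ≤ 8))).add
    (hbudget.const_mul (by positivity : 0 ≤ 20 * ℓ / (η * T)))).const_mul
    (by norm_num : (0 : ℝ) ≤ 4)).mono
    ((h.continuous_gradX.measurable.comp (hzm.fst.prodMk hstep)).norm.pow_const 2
      ).aestronglyMeasurable (fun _ => sq_nonneg _) (fun ω => ?_) ?_
  · have hbound := (isSaddleRun_saddleMethod ℓ η Y (a, y₀) T
      fun k z => G z (ξ k ω)).sq_norm_gradX_ascentStep_le hs h hℓ hY hx hη
      hp.sq_step_mul_le hp.steps_pos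
    rw [saddleMethod_queryAt_zero, mul_div_right_comm (16 : ℝ)] at hbound
    rw [hz, randomResult_saddleMethod_fst, randomResult_saddleMethod_snd]
    exact hbound
  · have hdist := hs.sq_norm_toLp_sub_le hℓ hY hx hεD hy₀
    calc _ ≤ 4 * (ε ^ 2 + 16 / (η * T) ^ 2 * (14 * D ^ 2 + 2 * D ^ 2) + 8 * (σ ^ 2 / T)
            + 20 * ℓ / (η * T) * (14 * D ^ 2)) := by gcongr
      _ = 4 * ε ^ 2 + 1024 * (D ^ 2 / (η * T) ^ 2) + 32 * (σ ^ 2 / T)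
            + 1120 * (ℓ / (η * T) * D ^ 2) := by ring
      _ ≤ (4 * ε) ^ 2 := by
        linarith [hp.div_mul_sq_le hℓ, hp.sq_div_sq_le hℓ hε hεD, hp.sq_div_le, sq_nonneg ε]

theorem IsStepSchedule.isStationaryPairInExpectation_saddleMethod
    (hp : IsStepSchedule ℓ D σ ε η T) (h : IsSmoothConcave ℓ Y f) (hℓ : 0 < ℓ)
    (hY : IsConstraintSet D Y) (hε : 0 < ε) (hεD : ε ≤ ℓ * D)
    (ha : IsMoreauStationary ℓ (maxFun Y f) ε a) (hy₀ : y₀ ∈ Y)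
    (hG : IsStochasticGradient P σ f G) (hξ : IsIIDSample P μ ξ) :
    IsStationaryPairInExpectation μ ℓ Y f (4 * ε)
      (fun ω => ((saddleMethod ℓ η Y (a, y₀) T).randomResult G ξ ω).1)
      (fun ω => ((saddleMethod ℓ η Y (a, y₀) T).randomResult G ξ ω).2) := by
  obtain ⟨x, y, hs⟩ := h.exists_isProxSaddle hℓ hY a
  have hx := (hs.isMoreauStationary_iff h hℓ hY).1 ha
  refine ⟨fun ω => ?_,
    hp.expectationLE_sq_norm_gradX_ascentStep hs h hℓ hY hx hε hεD hy₀ hG hξ rfl,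
    hp.expectationLE_sq_norm_ascentStep_sub hs h hℓ hY hx hεD hy₀ hG hξ rfl⟩
  simp only [randomResult_saddleMethod_snd]
  exact timeAvg_mem hY.convex hp.steps_pos ((isSaddleRun_saddleMethod ℓ η Y (a, y₀) T
    fun k z => G z (ξ k ω)).snd_mem hY)

end StochasticMethod

section StationaryPair

variable {m n : ℕ} {ℓ D σ ε : ℝ} {Y : Set (Euc n)} {f : Euc m → Euc n → ℝ}

theorem IsSmoothConcave.isStationaryPair_of_diam_le (h : IsSmoothConcave ℓ Y f) (hℓ : 0 < ℓ)
    (hY : IsConstraintSet D Y) (hε : 0 ≤ ε) (hD : ℓ * D ≤ ε) {a : Euc m}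
    (ha : IsMoreauStationary ℓ (maxFun Y f) ε a) {b : Euc n} (hb : b ∈ Y) :
    IsStationaryPair ℓ Y f (4 * ε) a b := by
  obtain ⟨x, y, hs⟩ := h.exists_isProxSaddle hℓ hY a
  have hx := (hs.isMoreauStationary_iff h hℓ hY).1 ha
  have hb' : ascentStep ℓ Y f a b ∈ Y := hY.projSet_mem _
  have hdiam : ∀ ⦃p q⦄, p ∈ Y → q ∈ Y → ℓ * ‖p - q‖ ≤ ε := fun p q hp hq =>
    (mul_le_mul_of_nonneg_left (hY.norm_sub_le hp hq) hℓ.le).trans hD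
  refine ⟨hb, ?_, ?_⟩
  · have hgrad := norm_gradX_le h hℓ.le hx a y (ascentStep ℓ Y f a b)
    rw [hs.regGradX_eq_zero, norm_zero, norm_sub_rev a x] at hgrad
    linarith [hdiam hb' hs.mem]
  · rw [le_div_iff₀' hℓ]
    linarith [hdiam hb' hb]

theorem isStationaryPairInExpectation_const_iff {Ω : Type*} [MeasurableSpace Ω] {μ : Measure Ω}
    [IsProbabilityMeasure μ] (hℓ : 0 ≤ ℓ) (hε : 0 ≤ ε) {x : Euc m} {y : Euc n} :
    IsStationaryPairInExpectation μ ℓ Y f ε (fun _ => x) (fun _ => y)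
      ↔ IsStationaryPair ℓ Y f ε x y := by
  have : Nonempty Ω := μ.nonempty_of_neZero
  simp [IsStationaryPairInExpectation, IsStationaryPair,
    sq_le_sq₀ (norm_nonneg _) hε, sq_le_sq₀ (norm_nonneg _) (div_nonneg hε hℓ)]

theorem IsSmoothConcave.isStochasticGradient_gradPair (h : IsSmoothConcave ℓ Y f) {Ξ : Type*}
    [MeasurableSpace Ξ] (P : Measure Ξ) [IsProbabilityMeasure P] :
    IsStochasticGradient P 0 f fun z _ => gradPair f z where
  measurable := h.continuous_gradPair.measurable.comp measurable_fst
  integrable _ := integrable_const _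
  unbiased _ := by simp
  sq_integrable _ := integrable_const _
  variance_le _ := by simp [gradPair]

end StationaryPair

theorem isIIDSample_infinitePi {Ξ : Type*} [MeasurableSpace Ξ] (P : Measure Ξ)
    [IsProbabilityMeasure P] :
    IsIIDSample P (Measure.infinitePi fun _ : ℕ => P) fun k ω => ω k where
  measurable := measurable_pi_apply
  map_eq := Measure.infinitePi_map_eval fun _ => P
  iIndepFun := iIndepFun_infinitePi (X := fun _ => id) fun _ => measurable_id

section Complexity

variable {m n : ℕ} {ℓ D σ ε : ℝ} {Y : Set (Euc n)}

theorem exists_isStepSchedule (hℓ : 0 < ℓ) (hε : 0 < ε) (hεD : ε ≤ ℓ * D) :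
    ∃ η T, IsStepSchedule ℓ D σ ε η T ∧
      (T : ℝ) ≤ 2 * 10 ^ 6 * ((ℓ * D) ^ 2 / ε ^ 2) * (1 + σ ^ 2 / ε ^ 2) := by
  set r := (ℓ * D) ^ 2 / ε ^ 2
  set q := 1 + σ ^ 2 / ε ^ 2 with hq
  have hr1 : 1 ≤ r := (one_le_div (by positivity)).2 (pow_le_pow_left₀ hε.le hεD 2)
  have hq1 : 1 ≤ q := le_add_of_nonneg_right (by positivity)
  have hrq : 1 ≤ r * q := one_le_mul_of_one_le_of_one_le hr1 hq1
  have hrε : r * ε ^ 2 = (ℓ * D) ^ 2 := div_mul_cancel₀ _ (by positivity)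
  have hqε : σ ^ 2 ≤ q * ε ^ 2 := by
    rw [hq, add_mul, div_mul_cancel₀ _ (by positivity)]
    linarith [sq_nonneg ε]
  obtain ⟨T, hT, hT'⟩ : ∃ T : ℕ, 10 ^ 6 * (r * q) ≤ T ∧ (T : ℝ) ≤ 2 * 10 ^ 6 * (r * q) :=
    ⟨⌈10 ^ 6 * (r * q)⌉₊, Nat.le_ceil _, by
      linarith [Nat.ceil_lt_add_one (by positivity : (0 : ℝ) ≤ 10 ^ 6 * (r * q))]⟩
  have hTε := mul_le_mul_of_nonneg_right hT (sq_nonneg ε)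
  refine ⟨1 / (1000 * ℓ * q), T, ⟨by positivity, ?_, ?_, ?_, ?_, ?_⟩, by linarith⟩
  · exact Nat.cast_pos.1 (by linarith : (0 : ℝ) < T)
  · rw [show 27 * (1 / (1000 * ℓ * q) * ℓ) ^ 2 = 27 / (10 ^ 6 * q ^ 2) by field_simp; norm_num,
      div_le_one (by positivity)]
    linarith [one_le_pow₀ hq1 (n := 2)]
  · rw [show 1 / (1000 * ℓ * q) * T * (ℓ * ε ^ 2) = T * ε ^ 2 / (1000 * q) by field_simp,
      le_div_iff₀ (by positivity), ← hrε]
    linarith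
  · rw [show (1 / (1000 * ℓ * q)) ^ 2 * T * σ ^ 2 = T * σ ^ 2 / (10 ^ 6 * ℓ ^ 2 * q ^ 2) by
      field_simp; ring, div_le_iff₀ (by positivity)]
    calc T * σ ^ 2 ≤ 2 * 10 ^ 6 * (r * q) * (q * ε ^ 2) := by gcongr
      _ = 2 * 10 ^ 6 * q ^ 2 * (r * ε ^ 2) := by ring
      _ = 2 * D ^ 2 * (10 ^ 6 * ℓ ^ 2 * q ^ 2) := by rw [hrε]; ring
  · calc 10 ^ 6 * σ ^ 2 ≤ 10 ^ 6 * (q * ε ^ 2) := by gcongr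
      _ ≤ 10 ^ 6 * (r * q * ε ^ 2) := by gcongr; exact le_mul_of_one_le_left (by positivity) hr1
      _ ≤ T * ε ^ 2 := by linarith

theorem exists_measurable_oracleMethod (hℓ : 0 < ℓ) (hY : IsConstraintSet D Y) (hε : 0 < ε)
    (σ : ℝ) (a : Euc m) :
    ∃ N : ℕ, (N : ℝ) ≤ 4 * 10 ^ 6 * ((ℓ * D) ^ 2 / ε ^ 2) * (1 + σ ^ 2 / ε ^ 2) ∧
      (N : ℝ) ≤ 4 * 10 ^ 6 * ((ℓ * D) ^ 2 / ε ^ 2) * ((ℓ * D) ^ 2 / ε ^ 2 + σ ^ 2 / ε ^ 2) ∧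
      ∃ A : OracleMethod (Euc m × Euc n) N, A.IsMeasurable ∧
        ∀ f : Euc m → Euc n → ℝ, IsSmoothConcave ℓ Y f →
          IsMoreauStationary ℓ (maxFun Y f) ε a →
          ∀ (Ξ : Type*) [MeasurableSpace Ξ] (P : Measure Ξ)
            (G : Euc m × Euc n → Ξ → Euc m × Euc n), IsStochasticGradient P σ f G →
          ∀ (Ω : Type*) [MeasurableSpace Ω] (μ : Measure Ω) [IsProbabilityMeasure μ]
            (ξ : ℕ → Ω → Ξ), IsIIDSample P μ ξ →
            IsStationaryPairInExpectation μ ℓ Y f (4 * ε)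
              (fun ω => (A.randomResult G ξ ω).1) (fun ω => (A.randomResult G ξ ω).2) := by
  obtain ⟨y₀, hy₀⟩ := hY.nonempty
  rcases lt_or_ge (ℓ * D) ε with hD | hD
  · refine ⟨0, by rw [Nat.cast_zero]; positivity, by rw [Nat.cast_zero]; positivity,
      ⟨fun _ _ => (a, y₀), fun _ => (a, y₀)⟩, ⟨fun _ => measurable_const, measurable_const⟩, ?_⟩
    intro f h ha Ξ _ P G _ Ω _ μ _ ξ _
    exact (isStationaryPairInExpectation_const_iff hℓ.le (by positivity)).2
      (h.isStationaryPair_of_diam_le hℓ hY hε.le hD.le ha hy₀)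
  · obtain ⟨η, T, hp, hT⟩ := exists_isStepSchedule (σ := σ) hℓ hε hD
    have hN : ((2 * T : ℕ) : ℝ) ≤ 4 * 10 ^ 6 * ((ℓ * D) ^ 2 / ε ^ 2) * (1 + σ ^ 2 / ε ^ 2) := by
      push_cast
      linarith
    refine ⟨2 * T, hN, hN.trans ?_, saddleMethod ℓ η Y (a, y₀) T,
      hY.isMeasurable_saddleMethod ℓ η (a, y₀) T, ?_⟩
    · gcongr
      exact (one_le_div (by positivity)).2 (pow_le_pow_left₀ hε.le hD 2)
    · intro f h ha Ξ _ P G hG Ω _ μ _ ξ hξ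
      exact hp.isStationaryPairInExpectation_saddleMethod h hℓ hY hε hD ha hy₀ hG hξ

end Complexity

theorem mainTheorem5 :
    -- from `Φ` to `f`, exact gradients
    (∃ K : ℝ, ∀ (m n : ℕ) (ℓ D : ℝ), 0 < ℓ → ∀ Y : Set (Euc n), IsConstraintSet D Y →
      ∀ ε : ℝ, 0 < ε → ∀ xhat : Euc m,
        ∃ N : ℕ, (N : ℝ) ≤ K * (ℓ * D) ^ 2 / ε ^ 2 ∧
        ∃ A : OracleMethod (Euc m × Euc n) N,
          ∀ f : Euc m → Euc n → ℝ, IsSmoothConcave ℓ Y f →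
            IsMoreauStationary ℓ (maxFun Y f) ε xhat →
            IsStationaryPair ℓ Y f (4 * ε)
              (A.result (fun _ => gradPair f)).1 (A.result (fun _ => gradPair f)).2) ∧
    -- from `Φ` to `f`, stochastic gradients
    (∃ K : ℝ, ∀ (m n : ℕ) (ℓ D σ : ℝ), 0 < ℓ → 0 ≤ σ →
      ∀ Y : Set (Euc n), IsConstraintSet D Y →
      ∀ ε : ℝ, 0 < ε → ∀ xhat : Euc m,
        ∃ N : ℕ, (N : ℝ) ≤ K * ((ℓ * D) ^ 2 * ((ℓ * D) ^ 2 + σ ^ 2)) / ε ^ 4 ∧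
        ∃ A : OracleMethod (Euc m × Euc n) N, A.IsMeasurable ∧
          ∀ f : Euc m → Euc n → ℝ, IsSmoothConcave ℓ Y f →
            IsMoreauStationary ℓ (maxFun Y f) ε xhat →
            ∀ (Ξ : Type*) [MeasurableSpace Ξ] (P : Measure Ξ)
              (G : Euc m × Euc n → Ξ → Euc m × Euc n), IsStochasticGradient P σ f G →
            ∀ (Ω : Type*) [MeasurableSpace Ω] (μ : Measure Ω) [IsProbabilityMeasure μ]
              (ξ : ℕ → Ω → Ξ), (∀ k, Measurable (ξ k)) → (∀ k, μ.map (ξ k) = P) →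
              iIndepFun ξ μ →
              IsStationaryPairInExpectation μ ℓ Y f (4 * ε)
                (fun ω => (A.result (fun k z => G z (ξ k ω))).1)
                (fun ω => (A.result (fun k z => G z (ξ k ω))).2)) ∧
    -- from `f` to `Φ`
    (∀ (m n : ℕ) (ℓ D : ℝ), 0 < ℓ → ∀ Y : Set (Euc n), IsConstraintSet D Y →
      ∀ f : Euc m → Euc n → ℝ, IsSmoothConcave ℓ Y f →
      ∀ ε : ℝ, 0 ≤ ε → ∀ (xhat : Euc m) (yhat : Euc n),
        IsStationaryPair ℓ Y f (ε ^ 2 / max 1 (ℓ * D)) xhat yhat →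
        IsMoreauStationary ℓ (maxFun Y f) (4 * ε ^ 2 + 4 * ε) xhat) := by
  refine ⟨⟨4 * 10 ^ 6, ?_⟩, ⟨4 * 10 ^ 6, ?_⟩, ?_⟩
  · intro m n ℓ D hℓ Y hY ε hε a
    obtain ⟨N, hN, -, A, -, hA⟩ := exists_measurable_oracleMethod hℓ hY hε 0 a
    refine ⟨N, hN.trans_eq (by simp [mul_div_assoc]), A, fun f h ha => ?_⟩
    exact (isStationaryPairInExpectation_const_iff hℓ.le (by positivity)).1
      (hA f h ha Unit _ _ (h.isStochasticGradient_gradPair (Measure.dirac ()))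
        (ℕ → Unit) _ _ (isIIDSample_infinitePi _))
  · intro m n ℓ D σ hℓ _ Y hY ε hε a
    obtain ⟨N, -, hN, A, hAm, hA⟩ := exists_measurable_oracleMethod hℓ hY hε σ a
    refine ⟨N, hN.trans_eq (by field_simp), A, hAm, ?_⟩
    intro f h ha Ξ _ P G hG Ω _ μ _ ξ hξ hP hind
    exact hA f h ha Ξ P G hG Ω μ ξ ⟨hξ, hP, hind⟩
  · intro m n ℓ D hℓ Y hY f h ε hε a b hs
    exact h.isMoreauStationary_of_isStationaryPair hℓ hY hε hs
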